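/- Let $n\ge 0$, let $G=\mathrm{PSL}(n+1,\mathbb C)$ be the group of automorphisms of the complex projective space $\mathbb P^n$, and for $g\in G$ let $L_g:\mathbb P^n\to\mathbb P^n$ be the corresponding automorphism. Let $(\mathbb P^n)^{(2)}=J^1(T\mathbb P^n)$ be the second prolongation of $\mathbb P^n$, that is, the total space of the bundle of $1$-jets $d^1s(p)$ of germs $s$ of holomorphic vector fields at points $p$ of $\mathbb P^n$, regarded as an algebraic variety. The group $G$ acts on $(\mathbb P^n)^{(2)}$ by prolongation: $g\cdot d^1s(p)=d^1s'(L_g(p))$, where $s'$ is the germ of vector field at $L_g(p)$ with $dL_g\circ s=s'\circ L_g$. Let $G^0\subset(\mathbb P^n)^{(2)}$ be the set of points $q$ whose isotropy group $G_q=\{g\in G: g\cdot q=q\}$ is trivial. Then $G^0$ is a non-empty Zariski open subset of $(\mathbb P^n)^{(2)}$, and for every $q\in G^0$: 1. the orbit map $\phi_q:G\to(\mathbb P^n)^{(2)}$, $g\mapsto g\cdot q$, is a birational morphism of algebraic varieties, that is, a morphism which restricts to an isomorphism from a dense open subset of $G$ onto a dense open subset of $(\mathbb P^n)^{(2)}$;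 2. $G\cdot q=G^0$. -/

import Mathlib

noncomputable section

open scoped Manifold ContDiff LinearAlgebra.Projectivization

namespace ProlongedProj

/-! ### Projective space as a complex manifold -/

/-- Complex projective space `ℙⁿ`. -/
abbrev ProjSpace (n : ℕ) : Type := ℙ ℂ (Fin (n + 1) → ℂ)

variable {n : ℕ}

/-- The canonical projection `ℂⁿ⁺¹ ∖ {0} → ℙⁿ`. -/
def proj (v : {v : Fin (n + 1) → ℂ // v ≠ 0}) : ProjSpace n := Projectivization.mk ℂ v.1 v.2

/-- `ℙⁿ` carries the quotient of the usual topology of `ℂⁿ⁺¹ ∖ {0}`. -/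
instance : TopologicalSpace (ProjSpace n) := TopologicalSpace.coinduced proj inferInstance

theorem proj_surjective : Function.Surjective (proj (n := n)) := fun p =>
  ⟨⟨p.rep, p.rep_nonzero⟩, p.mk_rep⟩

theorem isQuotientMap_proj : Topology.IsQuotientMap (proj (n := n)) :=
  ⟨⟨rfl⟩, proj_surjective⟩

/-- The affine coordinates `y_j = x_j / x_i` (`j ≠ i`) of a point of `ℙⁿ`, the indices `j ≠ i`
being listed in increasing order. -/
def affineCoord (i : Fin (n + 1)) (p : ProjSpace n) : Fin n → ℂ :=
  fun j => p.rep (i.succAbove j) / p.rep i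

/-- The point of `ℙⁿ` whose `i`-th homogeneous coordinate is `1` and whose other homogeneous
coordinates are given by `y`. -/
def affinePoint (i : Fin (n + 1)) (y : Fin n → ℂ) : ProjSpace n :=
  Projectivization.mk ℂ (i.insertNth (1 : ℂ) y : Fin (n + 1) → ℂ)
    (fun h => by simpa using congrFun h i)

theorem rep_mk (v : Fin (n + 1) → ℂ) (hv : v ≠ 0) :
    ∃ a : ℂ, a ≠ 0 ∧ (Projectivization.mk ℂ v hv).rep = a • v := by
  obtain ⟨a, ha⟩ := Projectivization.exists_smul_eq_mk_rep ℂ v hv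
  exact ⟨a, a.ne_zero, ha.symm⟩

theorem rep_mk_ne_zero_iff (i : Fin (n + 1)) (v : Fin (n + 1) → ℂ) (hv : v ≠ 0) :
    (Projectivization.mk ℂ v hv).rep i ≠ 0 ↔ v i ≠ 0 := by
  obtain ⟨a, ha, h⟩ := rep_mk v hv
  simp [h, ha]

theorem affineCoord_mk (i : Fin (n + 1)) (v : Fin (n + 1) → ℂ) (hv : v ≠ 0) :
    affineCoord i (Projectivization.mk ℂ v hv) = fun j => v (i.succAbove j) / v i := by
  obtain ⟨a, ha, h⟩ := rep_mk v hv
  funext j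
  simp only [affineCoord, h, Pi.smul_apply, smul_eq_mul]
  exact mul_div_mul_left _ _ ha

theorem continuous_coord (i : Fin (n + 1)) :
    Continuous fun v : {v : Fin (n + 1) → ℂ // v ≠ 0} => v.1 i :=
  (continuous_apply i).comp continuous_subtype_val

theorem isOpen_affine (i : Fin (n + 1)) : IsOpen {p : ProjSpace n | p.rep i ≠ 0} := by
  rw [← isQuotientMap_proj.isOpen_preimage]
  have : proj ⁻¹' {p : ProjSpace n | p.rep i ≠ 0} = {v | v.1 i ≠ 0} := by
    ext v; exact rep_mk_ne_zero_iff i v.1 v.2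
  rw [this]
  exact isOpen_ne_fun (continuous_coord i) continuous_const

theorem continuousOn_affineCoord (i : Fin (n + 1)) :
    ContinuousOn (affineCoord i) {p : ProjSpace n | p.rep i ≠ 0} := by
  rw [continuousOn_open_iff (isOpen_affine i)]
  intro t ht
  rw [← isQuotientMap_proj.isOpen_preimage]
  have : proj ⁻¹' ({p : ProjSpace n | p.rep i ≠ 0} ∩ affineCoord i ⁻¹' t)
      = {v | v.1 i ≠ 0} ∩ (fun v => fun j => v.1 (i.succAbove j) / v.1 i) ⁻¹' t := by
    ext v
    have h1 := rep_mk_ne_zero_iff i v.1 v.2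
    have h2 := affineCoord_mk i v.1 v.2
    simp only [proj, Set.mem_preimage, Set.mem_inter_iff, Set.mem_ofPred_eq, h2]
    exact and_congr_left fun _ => h1
  rw [this]
  refine ContinuousOn.isOpen_inter_preimage ?_ (isOpen_ne_fun (continuous_coord i) continuous_const) ht
  refine continuousOn_pi.2 fun j => ContinuousOn.div
    (continuous_coord _).continuousOn (continuous_coord i).continuousOn fun v hv => hv

theorem continuous_affinePoint (i : Fin (n + 1)) : Continuous (affinePoint (n := n) i) := by
  have h : Continuous fun y : Fin n → ℂ =>
      (⟨(i.insertNth (1 : ℂ) y : Fin (n + 1) → ℂ), fun h => by simpa using congrFun h i⟩ :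
        {v : Fin (n + 1) → ℂ // v ≠ 0}) := by
    refine Continuous.subtype_mk ?_ _
    exact continuous_const.finInsertNth i continuous_id
  exact isQuotientMap_proj.continuous.comp h

/-- The standard affine chart of `ℙⁿ` on the open set where the `i`-th homogeneous coordinate
does not vanish. -/
def affineChart (i : Fin (n + 1)) : OpenPartialHomeomorph (ProjSpace n) (Fin n → ℂ) where
  toFun := affineCoord i
  invFun := affinePoint i
  source := {p | p.rep i ≠ 0}
  target := Set.univ
  map_source' _ _ := trivial
  map_target' y _ := (rep_mk_ne_zero_iff i _ _).2 (by simp)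
  left_inv' p hp := by
    conv_rhs => rw [← p.mk_rep]
    refine (Projectivization.mk_eq_mk_iff' ℂ _ _ _ _).2 ⟨(p.rep i)⁻¹, ?_⟩
    funext k
    refine Fin.succAboveCases i ?_ (fun j => ?_) k
    · simpa using inv_mul_cancel₀ hp
    · simp [affineCoord, div_eq_inv_mul]
  right_inv' y _ := by
    rw [affinePoint, affineCoord_mk]
    funext j
    simp
  continuousOn_toFun := continuousOn_affineCoord i
  continuousOn_invFun := (continuous_affinePoint i).continuousOn
  open_source := isOpen_affine i
  open_target := isOpen_univ

theorem exists_rep_ne_zero (p : ProjSpace n) : ∃ i, p.rep i ≠ 0 := by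
  by_contra! h
  exact p.rep_nonzero (funext h)

/-- The complex manifold structure of `ℙⁿ`, given by the standard affine charts. -/
instance : ChartedSpace (Fin n → ℂ) (ProjSpace n) where
  atlas := Set.range affineChart
  chartAt p := affineChart (exists_rep_ne_zero p).choose
  mem_chart_source p := (exists_rep_ne_zero p).choose_spec
  chart_mem_atlas _ := ⟨_, rfl⟩

theorem contDiff_insertNth (i k : Fin (n + 1)) :
    ContDiff ℂ ω fun y : Fin n → ℂ => (i.insertNth (1 : ℂ) y : Fin (n + 1) → ℂ) k := by
  refine Fin.succAboveCases i ?_ (fun j => ?_) k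
  · simpa using contDiff_const
  · simpa using contDiff_apply ℂ ℂ j

instance : IsManifold 𝓘(ℂ, Fin n → ℂ) ω (ProjSpace n) := by
  refine isManifold_of_contDiffOn _ _ _ ?_
  rintro _ _ ⟨i, rfl⟩ ⟨j, rfl⟩
  have key : ∀ y : Fin n → ℂ, affineCoord j (affinePoint i y) = fun k =>
      (i.insertNth (1 : ℂ) y : Fin (n + 1) → ℂ) (j.succAbove k) /
        (i.insertNth (1 : ℂ) y : Fin (n + 1) → ℂ) j := fun y => affineCoord_mk _ _ _
  have : ContDiffOn ℂ ω (fun y => affineCoord j (affinePoint i y))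
      {y : Fin n → ℂ | (i.insertNth (1 : ℂ) y : Fin (n + 1) → ℂ) j ≠ 0} := by
    simp only [key]
    exact contDiffOn_pi.2 fun k =>
      (contDiff_insertNth i _).contDiffOn.div (contDiff_insertNth i j).contDiffOn fun y hy => hy
  refine this.mono ?_
  rintro y ⟨⟨-, hy⟩, -⟩
  exact (rep_mk_ne_zero_iff j _ _).1 hy

/-! ### The action of `PSL(n+1, ℂ)` on `ℙⁿ` -/

/-- `PSL(n+1, ℂ)`. -/
abbrev PSL (n : ℕ) : Type := Matrix.ProjectiveSpecialLinearGroup (Fin (n + 1)) ℂ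

theorem mk_smul_mk (A : Matrix.SpecialLinearGroup (Fin (n + 1)) ℂ) (v : Fin (n + 1) → ℂ)
    (hv : v ≠ 0) : ∃ h : A.1.mulVec v ≠ 0,
      (QuotientGroup.mk A : PSL n) • (Projectivization.mk ℂ v hv : ProjSpace n) =
      Projectivization.mk ℂ (A.1.mulVec v) h :=
  ⟨(smul_ne_zero_iff_ne A).mpr hv, rfl⟩

theorem continuous_smul_proj (g : PSL n) : Continuous fun p : ProjSpace n => g • p := by
  induction g using QuotientGroup.induction_on with | _ A
  rw [isQuotientMap_proj.continuous_iff]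
  have : ((fun p : ProjSpace n => (QuotientGroup.mk A : PSL n) • p) ∘ proj) =
      proj ∘ fun v => ⟨A.1.mulVec v.1, (mk_smul_mk A v.1 v.2).choose⟩ := by
    funext v
    exact (mk_smul_mk A v.1 v.2).choose_spec
  rw [this]
  refine isQuotientMap_proj.continuous.comp (Continuous.subtype_mk ?_ _)
  exact Continuous.matrix_mulVec continuous_const continuous_subtype_val

theorem contMDiff_smul_proj (g : PSL n) :
    ContMDiff 𝓘(ℂ, Fin n → ℂ) 𝓘(ℂ, Fin n → ℂ) ω fun p : ProjSpace n => g • p := by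
  refine contMDiff_iff.2 ⟨continuous_smul_proj g, fun x y => ?_⟩
  induction g using QuotientGroup.induction_on with | _ A
  set i := (exists_rep_ne_zero x).choose
  set j := (exists_rep_ne_zero y).choose
  have key : ∀ u : Fin n → ℂ,
      affineCoord j ((QuotientGroup.mk A : PSL n) • affinePoint i u) = fun k =>
      A.1.mulVec (i.insertNth (1 : ℂ) u) (j.succAbove k) /
        A.1.mulVec (i.insertNth (1 : ℂ) u) j := fun u => by
    obtain ⟨h, e⟩ := mk_smul_mk A (i.insertNth (1 : ℂ) u) (fun h => by simpa using congrFun h i)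
    rw [affinePoint, e, affineCoord_mk]
  have hc : ∀ k, ContDiff ℂ ω fun u : Fin n → ℂ => A.1.mulVec (i.insertNth (1 : ℂ) u) k := by
    intro k
    simp only [Matrix.mulVec, dotProduct]
    exact ContDiff.sum fun l _ => contDiff_const.mul (contDiff_insertNth i l)
  have : ContDiffOn ℂ ω (fun u => affineCoord j ((QuotientGroup.mk A : PSL n) • affinePoint i u))
      {u : Fin n → ℂ | A.1.mulVec (i.insertNth (1 : ℂ) u) j ≠ 0} := by
    simp only [key]
    exact contDiffOn_pi.2 fun k => (hc _).contDiffOn.div (hc j).contDiffOn fun y hy => hy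
  refine this.mono ?_
  rintro u ⟨-, hu⟩
  have hu' : ((QuotientGroup.mk A : PSL n) • affinePoint i u).rep j ≠ 0 := by
    rw [extChartAt_source] at hu
    exact hu
  obtain ⟨h, e⟩ := mk_smul_mk A (i.insertNth (1 : ℂ) u) (fun h => by simpa using congrFun h i)
  rw [affinePoint, e] at hu'
  exact (rep_mk_ne_zero_iff j _ _).1 hu'

/-- The automorphism `L_g` of the complex manifold `ℙⁿ` given by `g ∈ PSL(n+1, ℂ)`. -/
def leftTranslation (g : PSL n) :
    Diffeomorph 𝓘(ℂ, Fin n → ℂ) 𝓘(ℂ, Fin n → ℂ) (ProjSpace n) (ProjSpace n) ω where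
  toEquiv := MulAction.toPerm g
  contMDiff_toFun := contMDiff_smul_proj g
  contMDiff_invFun := contMDiff_smul_proj g⁻¹

/-! ### The bundle of 1-jets of holomorphic vector fields -/

section Jets

variable (E : Type*) [NormedAddCommGroup E] [NormedSpace ℂ E]
  (M : Type*) [TopologicalSpace M] [ChartedSpace E M] [IsManifold 𝓘(ℂ, E) ω M]

/-- A germ of holomorphic vector field at a point `base` of the complex manifold `M`: a section of
the tangent bundle that is holomorphic in a neighbourhood of `base` (its values away from `base`
play no role, as they are not seen by `VectorFieldGerm.SameJet` below). -/
structure VectorFieldGerm where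
  base : M
  toFun : M → TangentBundle 𝓘(ℂ, E) M
  proj_toFun : ∀ x, (toFun x).proj = x
  holomorphic : ContMDiffAt 𝓘(ℂ, E) (𝓘(ℂ, E).tangent) ω toFun base

variable {E M}

/-- Two germs of vector fields have the same 1-jet: they are germs at the same point `p`, and as
maps `M → TM` they have the same value and the same derivative at `p` (equivalently, in local
coordinates at `p`, their components have the same value and the same first partial derivatives at
`p`). -/
def VectorFieldGerm.SameJet (s t : VectorFieldGerm E M) : Prop :=
  s.base = t.base ∧ ∀ v : TangentBundle 𝓘(ℂ, E) M, v.proj = s.base →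
    tangentMap 𝓘(ℂ, E) (𝓘(ℂ, E).tangent) s.toFun v =
      tangentMap 𝓘(ℂ, E) (𝓘(ℂ, E).tangent) t.toFun v

variable (E M) in
/-- Having the same 1-jet is an equivalence relation. -/
def jetSetoid : Setoid (VectorFieldGerm E M) where
  r := VectorFieldGerm.SameJet
  iseqv :=
    { refl := fun _ => ⟨rfl, fun _ _ => rfl⟩
      symm := fun h => ⟨h.1.symm, fun v hv => (h.2 v (hv.trans h.1.symm)).symm⟩
      trans := fun h k => ⟨h.1.trans k.1, fun v hv => (h.2 v hv).trans (k.2 v (hv.trans h.1))⟩ }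

variable (E M) in
/-- The total space of the bundle `J¹(TM)` of 1-jets of holomorphic vector fields on `M`, that is,
the second prolongation `M⁽²⁾` of `M`. -/
def SecondProlongation := Quotient (jetSetoid E M)

/-- The 1-jet of a germ of vector field. -/
def jet (s : VectorFieldGerm E M) : SecondProlongation E M := Quotient.mk (jetSetoid E M) s

/-- The projection `J¹(TM) → M`. -/
def SecondProlongation.base (q : SecondProlongation E M) : M :=
  Quotient.lift (fun s : VectorFieldGerm E M => s.base) (fun _ _ h => And.left h) q

/-- The image of a germ of vector field `s` under an automorphism `φ` of `M`: the germ `s'` such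
that `dφ ∘ s = s' ∘ φ`. -/
def VectorFieldGerm.pushforward (φ : Diffeomorph 𝓘(ℂ, E) 𝓘(ℂ, E) M M ω)
    (s : VectorFieldGerm E M) : VectorFieldGerm E M where
  base := φ s.base
  toFun x := tangentMap 𝓘(ℂ, E) 𝓘(ℂ, E) φ (s.toFun (φ.symm x))
  proj_toFun x := by
    change φ (s.toFun (φ.symm x)).proj = x
    rw [s.proj_toFun]
    exact φ.apply_symm_apply x
  holomorphic := by
    have h1 : ContMDiff (𝓘(ℂ, E).tangent) (𝓘(ℂ, E).tangent) ω
        (tangentMap 𝓘(ℂ, E) 𝓘(ℂ, E) φ) := φ.contMDiff_toFun.contMDiff_tangentMap le_rfl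
    have h2 : ContMDiffAt 𝓘(ℂ, E) 𝓘(ℂ, E) ω φ.symm (φ s.base) := φ.symm.contMDiff_toFun _
    have h3 := s.holomorphic
    rw [← φ.symm_apply_apply s.base] at h3
    exact (h1 _).comp _ (h3.comp _ h2)

theorem omega_ne_zero : (ω : WithTop ℕ∞) ≠ 0 := by simp

theorem tangentMap_pushforward (φ : Diffeomorph 𝓘(ℂ, E) 𝓘(ℂ, E) M M ω)
    (s : VectorFieldGerm E M) (v : TangentBundle 𝓘(ℂ, E) M) (hv : v.proj = φ s.base) :
    tangentMap 𝓘(ℂ, E) (𝓘(ℂ, E).tangent) (s.pushforward φ).toFun v =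
      tangentMap (𝓘(ℂ, E).tangent) (𝓘(ℂ, E).tangent) (tangentMap 𝓘(ℂ, E) 𝓘(ℂ, E) φ)
        (tangentMap 𝓘(ℂ, E) (𝓘(ℂ, E).tangent) s.toFun
          (tangentMap 𝓘(ℂ, E) 𝓘(ℂ, E) φ.symm v)) := by
  have h1 : ContMDiff (𝓘(ℂ, E).tangent) (𝓘(ℂ, E).tangent) ω
      (tangentMap 𝓘(ℂ, E) 𝓘(ℂ, E) φ) := φ.contMDiff_toFun.contMDiff_tangentMap le_rfl
  have h2 : ContMDiffAt 𝓘(ℂ, E) 𝓘(ℂ, E) ω φ.symm v.proj := φ.symm.contMDiff_toFun _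
  have h3 : ContMDiffAt 𝓘(ℂ, E) (𝓘(ℂ, E).tangent) ω s.toFun (φ.symm v.proj) := by
    have := s.holomorphic
    rwa [← φ.symm_apply_apply s.base, ← hv] at this
  have e : (s.pushforward φ).toFun =
      (tangentMap 𝓘(ℂ, E) 𝓘(ℂ, E) φ) ∘ (s.toFun ∘ φ.symm) := rfl
  rw [e, tangentMap_comp_at v ((h1 _).mdifferentiableAt omega_ne_zero)
    ((h3.comp _ h2).mdifferentiableAt omega_ne_zero),
    tangentMap_comp_at v (h3.mdifferentiableAt omega_ne_zero)
      (h2.mdifferentiableAt omega_ne_zero)]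

/-- The prolongation `φ⁽²⁾ : J¹(TM) → J¹(TM)` of an automorphism `φ` of `M`: it is the map
such that `φ⁽²⁾ (d¹s) = d¹s'` for every germ `s`, where `dφ ∘ s = s' ∘ φ`. -/
def prolong (φ : Diffeomorph 𝓘(ℂ, E) 𝓘(ℂ, E) M M ω) :
    SecondProlongation E M → SecondProlongation E M :=
  Quotient.map' (s₁ := jetSetoid E M) (s₂ := jetSetoid E M)
    (VectorFieldGerm.pushforward φ) (by
      rintro s t ⟨h, hst⟩
      refine ⟨congrArg φ h, fun v hv => ?_⟩
      rw [tangentMap_pushforward φ s v hv,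
        tangentMap_pushforward φ t v (hv.trans (congrArg φ h)), hst]
      change φ.symm v.proj = s.base
      rw [hv]
      exact φ.symm_apply_apply _)

theorem prolong_jet (φ : Diffeomorph 𝓘(ℂ, E) 𝓘(ℂ, E) M M ω) (s : VectorFieldGerm E M) :
    prolong φ (jet s) = jet (s.pushforward φ) := rfl

theorem VectorFieldGerm.ext' {s t : VectorFieldGerm E M} (h : s.base = t.base)
    (h' : s.toFun = t.toFun) : s = t := by
  cases s; cases t; cases h; cases h'; rfl

theorem prolong_eq_self (φ : Diffeomorph 𝓘(ℂ, E) 𝓘(ℂ, E) M M ω) (hφ : ∀ x, φ x = x)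
    (q : SecondProlongation E M) : prolong φ q = q := by
  induction q using Quotient.inductionOn with | _ s
  refine congrArg jet (VectorFieldGerm.ext' (hφ _) (funext fun x => ?_))
  have h1 : (φ : M → M) = id := funext hφ
  have h2 : φ.symm x = x := by
    conv_lhs => rw [← hφ x]
    exact φ.symm_apply_apply x
  change tangentMap 𝓘(ℂ, E) 𝓘(ℂ, E) φ (s.toFun (φ.symm x)) = s.toFun x
  rw [h1, h2, tangentMap_id]
  rfl

theorem prolong_comp (φ ψ χ : Diffeomorph 𝓘(ℂ, E) 𝓘(ℂ, E) M M ω) (h : ∀ x, χ x = φ (ψ x))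
    (q : SecondProlongation E M) : prolong χ q = prolong φ (prolong ψ q) := by
  induction q using Quotient.inductionOn with | _ s
  refine congrArg jet (VectorFieldGerm.ext' (h _) (funext fun x => ?_))
  have h1 : (χ : M → M) = φ ∘ ψ := funext h
  have h2 : χ.symm x = ψ.symm (φ.symm x) := by
    refine χ.injective ?_
    change χ (χ.symm x) = χ (ψ.symm (φ.symm x))
    rw [h (ψ.symm _), χ.apply_symm_apply, ψ.apply_symm_apply, φ.apply_symm_apply]
  change tangentMap 𝓘(ℂ, E) 𝓘(ℂ, E) χ (s.toFun (χ.symm x)) =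
    tangentMap 𝓘(ℂ, E) 𝓘(ℂ, E) φ (tangentMap 𝓘(ℂ, E) 𝓘(ℂ, E) ψ
      (s.toFun (ψ.symm (φ.symm x))))
  rw [h1, h2, tangentMap_comp (φ.mdifferentiable omega_ne_zero)
    (ψ.mdifferentiable omega_ne_zero)]
  rfl

/-- The components, in the chart `e`, of a vector field `s` on `M`: with `e = (x₁, …, xₙ)` and
`s = ∑ f_k ∂/∂x_k`, this is the map `x ↦ (f₁, …, fₙ)` in the coordinates given by `e`. -/
def components (e : OpenPartialHomeomorph M E) (s : M → TangentBundle 𝓘(ℂ, E) M) : E → E :=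
  fun u => (tangentMap 𝓘(ℂ, E) 𝓘(ℂ, E) e (s (e.symm u))).2

theorem fderiv_components (e : OpenPartialHomeomorph M E) (he : e ∈ atlas E M)
    (s : VectorFieldGerm E M) (hs : s.base ∈ e.source) (v : E) :
    fderiv ℂ (components e s.toFun) (e s.base) v =
      (tangentMap (𝓘(ℂ, E).tangent) 𝓘(ℂ, E) (fun p => p.2)
        (tangentMap (𝓘(ℂ, E).tangent) (𝓘(ℂ, E).tangent) (tangentMap 𝓘(ℂ, E) 𝓘(ℂ, E) e)
          (tangentMap 𝓘(ℂ, E) (𝓘(ℂ, E).tangent) s.toFun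
            (tangentMap 𝓘(ℂ, E) 𝓘(ℂ, E) e.symm ⟨e s.base, v⟩)))).2 := by
  have he1 : e ∈ IsManifold.maximalAtlas 𝓘(ℂ, E) ω M :=
    IsManifold.subset_maximalAtlas he
  have hsymm : ContMDiffAt 𝓘(ℂ, E) 𝓘(ℂ, E) ω e.symm (e s.base) :=
    contMDiffAt_symm_of_mem_maximalAtlas he1 (e.map_source hs)
  have hs' : ContMDiffAt 𝓘(ℂ, E) (𝓘(ℂ, E).tangent) ω s.toFun (e.symm (e s.base)) := by
    rw [e.left_inv hs]; exact s.holomorphic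
  have hF : ContMDiffAt (𝓘(ℂ, E).tangent) (𝓘(ℂ, E).tangent) ω (tangentMap 𝓘(ℂ, E) 𝓘(ℂ, E) e)
      (s.toFun (e.symm (e s.base))) := by
    have h1 := (contMDiffOn_of_mem_maximalAtlas (I := 𝓘(ℂ, E)) (n := ω) he1).contMDiffOn_tangentMapWithin
      (m := ω) le_rfl e.open_source.uniqueMDiffOn
    have hopen : IsOpen (Bundle.TotalSpace.proj ⁻¹' e.source : Set (TangentBundle 𝓘(ℂ, E) M)) :=
      e.open_source.preimage (FiberBundle.continuous_proj E _)
    have hmem : s.toFun (e.symm (e s.base)) ∈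
        (Bundle.TotalSpace.proj ⁻¹' e.source : Set (TangentBundle 𝓘(ℂ, E) M)) := by
      change (s.toFun (e.symm (e s.base))).proj ∈ e.source
      rw [s.proj_toFun, e.left_inv hs]
      exact hs
    refine (h1.contMDiffAt (hopen.mem_nhds hmem)).congr_of_eventuallyEq ?_
    filter_upwards [hopen.mem_nhds hmem] with p hp
    exact (tangentMapWithin_eq_tangentMap (e.open_source.uniqueMDiffOn _ hp)
      ((contMDiffAt_of_mem_maximalAtlas he1 hp).mdifferentiableAt omega_ne_zero)).symm
  have hsnd : ContMDiff (𝓘(ℂ, E).tangent) 𝓘(ℂ, E) ω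
      (fun p : TangentBundle 𝓘(ℂ, E) E => (p.2 : E)) :=
    contMDiff_snd_tangentBundle_modelSpace E 𝓘(ℂ, E)
  have hcomp : components e s.toFun = (fun p : TangentBundle 𝓘(ℂ, E) E => (p.2 : E)) ∘
      (tangentMap 𝓘(ℂ, E) 𝓘(ℂ, E) e ∘ (s.toFun ∘ e.symm)) := rfl
  have h0 : fderiv ℂ (components e s.toFun) (e s.base) v =
      (tangentMap 𝓘(ℂ, E) 𝓘(ℂ, E) (components e s.toFun)
        (⟨e s.base, v⟩ : TangentBundle 𝓘(ℂ, E) E)).2 := by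
    simp only [tangentMap, mfderiv_eq_fderiv]
    rfl
  have h1 := hs'.comp _ hsymm
  have h2 := ContMDiffAt.comp (e s.base) hF h1
  rw [h0, hcomp, tangentMap_comp_at _ ((hsnd _).mdifferentiableAt omega_ne_zero)
      (h2.mdifferentiableAt omega_ne_zero),
    tangentMap_comp_at _ (hF.mdifferentiableAt omega_ne_zero)
      (h1.mdifferentiableAt omega_ne_zero),
    tangentMap_comp_at _ (hs'.mdifferentiableAt omega_ne_zero)
      (hsymm.mdifferentiableAt omega_ne_zero)]

open Classical in
/-- The coordinates `x = e(p)`, `z = f(p)`, `w = Df(p)` of the 1-jet of a germ `∑ f_k ∂/∂x_k` of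
vector field at a point `p` of the domain of the chart `e = (x₁, …, xₙ)` (and zero if `p` does not
lie in the domain of `e`). -/
def germCoord (e : OpenPartialHomeomorph M E) (s : VectorFieldGerm E M) : E × E × (E →L[ℂ] E) :=
  if s.base ∈ e.source then
    (e s.base, components e s.toFun (e s.base), fderiv ℂ (components e s.toFun) (e s.base))
  else 0

theorem germCoord_congr (e : OpenPartialHomeomorph M E) (he : e ∈ atlas E M)
    (s t : VectorFieldGerm E M) (hst : s.SameJet t) : germCoord e s = germCoord e t := by
  obtain ⟨h, hst⟩ := hst
  by_cases hs : s.base ∈ e.source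
  · have ht : t.base ∈ e.source := h ▸ hs
    rw [germCoord, germCoord, if_pos hs, if_pos ht]
    refine Prod.ext (congrArg e h) (Prod.ext ?_ ?_)
    · have h0 := congrArg Bundle.TotalSpace.proj (hst ⟨s.base, 0⟩ rfl)
      change s.toFun s.base = t.toFun s.base at h0
      dsimp only [components]
      rw [← h, e.left_inv hs, h0]
    · ext v
      have : (tangentMap 𝓘(ℂ, E) 𝓘(ℂ, E) e.symm
        (⟨e s.base, v⟩ : TangentBundle 𝓘(ℂ, E) E)).proj = s.base := e.left_inv hs
      dsimp only
      rw [fderiv_components e he s hs v, fderiv_components e he t ht v, ← h, hst _ this]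
  · have ht : t.base ∉ e.source := h ▸ hs
    rw [germCoord, germCoord, if_neg hs, if_neg ht]

/-- The natural coordinates `(x, z, w)` of `J¹(TM)` over the domain of a chart `e` of `M`. -/
def jetCoord (e : OpenPartialHomeomorph M E) (he : e ∈ atlas E M) (q : SecondProlongation E M) :
    E × E × (E →L[ℂ] E) :=
  Quotient.lift (germCoord e) (germCoord_congr e he) q

end Jets

/-! ### Algebraic varieties over `ℂ`, morphisms and birational morphisms -/

/-- A presentation of an algebraic variety structure on a set `X`: pieces `piece i`, each of them
a set of points of a complex affine space through the coordinates `coord i`, and maps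
`toSpace i : piece i → X`. The set `X` is regarded as the quotient of the disjoint union of the
pieces (for pieces that are subsets of `X`, the pieces are glued to give `X`). -/
structure VarietyData (X : Type*) where
  index : Type
  piece : index → Type
  toSpace : ∀ i, piece i → X
  vars : index → Type
  coord : ∀ i, piece i → vars i → ℂ

section Varieties

variable {X Y : Type*}

/-- The Zariski topology: `V ⊆ X` is open if its inverse image in every piece is the
complement of the zero set of a family of polynomials in the coordinates. -/
@[reducible]
def VarietyData.zariski (A : VarietyData X) : TopologicalSpace X where
  IsOpen V := ∀ i, ∃ S : Set (MvPolynomial (A.vars i) ℂ),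
    ∀ c, A.toSpace i c ∈ V ↔ ∃ P ∈ S, MvPolynomial.eval (A.coord i c) P ≠ 0
  isOpen_univ i := ⟨{1}, fun c => by simp⟩
  isOpen_inter V W hV hW i := by
    obtain ⟨S, hS⟩ := hV i
    obtain ⟨T, hT⟩ := hW i
    refine ⟨{R | ∃ P ∈ S, ∃ Q ∈ T, R = P * Q}, fun c => ?_⟩
    rw [Set.mem_inter_iff, hS, hT]
    constructor
    · rintro ⟨⟨P, hP, hP'⟩, Q, hQ, hQ'⟩
      exact ⟨P * Q, ⟨P, hP, Q, hQ, rfl⟩, by simp [hP', hQ']⟩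
    · rintro ⟨_, ⟨P, hP, Q, hQ, rfl⟩, h⟩
      rw [map_mul] at h
      exact ⟨⟨P, hP, left_ne_zero_of_mul h⟩, Q, hQ, right_ne_zero_of_mul h⟩
  isOpen_sUnion 𝒱 h𝒱 i := by
    choose S hS using fun (V : 𝒱) => h𝒱 V.1 V.2 i
    refine ⟨⋃ V, S V, fun c => ?_⟩
    rw [Set.mem_sUnion]
    constructor
    · rintro ⟨V, hV, hc⟩
      obtain ⟨P, hP, hP'⟩ := (hS ⟨V, hV⟩ c).1 hc
      exact ⟨P, Set.mem_iUnion.2 ⟨_, hP⟩, hP'⟩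
    · rintro ⟨P, hP, hP'⟩
      obtain ⟨V, hV⟩ := Set.mem_iUnion.1 hP
      exact ⟨V.1, V.2, (hS V c).2 ⟨P, hV, hP'⟩⟩

/-- Zariski open subsets. -/
def VarietyData.IsZariskiOpen (A : VarietyData X) (V : Set X) : Prop := @IsOpen X A.zariski V

/-- Zariski dense subsets. -/
def VarietyData.IsZariskiDense (A : VarietyData X) (V : Set X) : Prop := @Dense X A.zariski V

/-- A complex-valued function `h` is regular at `x` if near every point over `x` it is a quotient
of two polynomials in the coordinates (basic open sets `Q ≠ 0` form a basis of
neighbourhoods, so that it is enough to consider these). -/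
def VarietyData.RegularAt (A : VarietyData X) (h : X → ℂ) (x : X) : Prop :=
  ∀ i c, A.toSpace i c = x → ∃ P Q : MvPolynomial (A.vars i) ℂ,
    MvPolynomial.eval (A.coord i c) Q ≠ 0 ∧
      ∀ c', MvPolynomial.eval (A.coord i c') Q ≠ 0 →
        h (A.toSpace i c') =
          MvPolynomial.eval (A.coord i c') P / MvPolynomial.eval (A.coord i c') Q

/-- `f` is a morphism of varieties near `x`: it is Zariski continuous at `x` and pulls functions
that are regular at `f x` back to functions that are regular at `x`. -/
def IsMorphismAt (A : VarietyData X) (B : VarietyData Y) (f : X → Y) (x : X) : Prop :=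
  @ContinuousAt X Y A.zariski B.zariski f x ∧
    ∀ h : Y → ℂ, B.RegularAt h (f x) → A.RegularAt (h ∘ f) x

/-- `f` is a birational morphism: it is a morphism everywhere, and it restricts to an isomorphism
(with inverse `g`) from a dense open subset of `X` onto a dense open subset of `Y`. -/
def IsBirationalMorphism (A : VarietyData X) (B : VarietyData Y) (f : X → Y) : Prop :=
  (∀ x, IsMorphismAt A B f x) ∧
    ∃ (U : Set X) (V : Set Y) (g : Y → X),
      A.IsZariskiOpen U ∧ A.IsZariskiDense U ∧ B.IsZariskiOpen V ∧ B.IsZariskiDense V ∧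
      Set.MapsTo f U V ∧ Set.MapsTo g V U ∧ Set.LeftInvOn g f U ∧ Set.RightInvOn g f V ∧
      ∀ y ∈ V, IsMorphismAt B A g y

end Varieties

/-! ### `PSL(n+1, ℂ)` and the second prolongation of `ℙⁿ` -/

/-- `PSL(n+1, ℂ)` as an algebraic variety: the quotient of the closed subset `SL(n+1, ℂ)` of the
affine space of matrices by the centre. -/
def pslVariety (n : ℕ) : VarietyData (PSL n) where
  index := Unit
  piece _ := Matrix.SpecialLinearGroup (Fin (n + 1)) ℂ
  toSpace _ A := QuotientGroup.mk A
  vars _ := Fin (n + 1) × Fin (n + 1)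
  coord _ A := fun ij => A.1 ij.1 ij.2

/-- The second prolongation `(ℙⁿ)⁽²⁾ = J¹(Tℙⁿ)` of `ℙⁿ`. -/
abbrev ProjProlongation (n : ℕ) : Type := SecondProlongation (Fin n → ℂ) (ProjSpace n)

/-- The coordinates `(y, z, w)` of `(ℙⁿ)⁽²⁾` over the `i`-th standard affine chart: the 1-jet
at a point of `∑ f_k ∂/∂y_k` has `z_j = f_j` and `w_{jk} = ∂f_k/∂y_j`. -/
def affineJetCoord (i : Fin (n + 1)) (q : ProjProlongation n) :
    Fin n ⊕ Fin n ⊕ Fin n × Fin n → ℂ :=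
  let c := jetCoord (affineChart i) (Set.mem_range_self i) q
  Sum.elim c.1 (Sum.elim c.2.1 fun jk => c.2.2 (Pi.single jk.1 1) jk.2)

/-- `(ℙⁿ)⁽²⁾` as an algebraic variety: it is glued from its open subsets over the standard
affine charts of `ℙⁿ`, on which `(y, z, w)` are affine coordinates. -/
def prolongationVariety (n : ℕ) : VarietyData (ProjProlongation n) where
  index := Fin (n + 1)
  piece i := {q : ProjProlongation n // q.base ∈ (affineChart i).source}
  toSpace _ q := q.1
  vars _ := Fin n ⊕ Fin n ⊕ Fin n × Fin n
  coord i q := affineJetCoord i q.1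

/-- The action of `PSL(n+1, ℂ)` on `(ℙⁿ)⁽²⁾`, by prolongation of its action on `ℙⁿ`. -/
instance : MulAction (PSL n) (ProjProlongation n) where
  smul g q := prolong (leftTranslation g) q
  one_smul q := prolong_eq_self _ (fun x => one_smul (PSL n) x) q
  mul_smul g h q := prolong_comp _ _ _ (fun x => mul_smul g h x) q

/-- The set `G⁰` of points of `(ℙⁿ)⁽²⁾` whose isotropy group in `PSL(n+1, ℂ)` is trivial. -/
def trivialIsotropy (n : ℕ) : Set (ProjProlongation n) :=
  {q | MulAction.stabilizer (PSL n) q = ⊥}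

end ProlongedProj

end

/-! Every 1-jet of vector field at `[v]` in `ℙⁿ` is the 1-jet of a field induced by a linear field
`x ↦ B x` on `ℂⁿ⁺¹` (`exists_eq_linearJet`). The matrix `B` matters only modulo scalars, which
induce the zero field, and modulo `v ⊗ l` with `l(v) = 0`, whose fields vanish to second order at
`[v]`. A matrix `A` in `SL` sends the jet of `(v, B)` to that of `(A v, A B A⁻¹)`
(`mk_smul_linearJet`). The theorem thus becomes linear algebra about a vector and an endomorphism.

Take `B` trace-free, with characteristic polynomial `∑ c_j X^j`, and put `f₀ = v`, `f_{k+1} = B f_k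
+ c_{n-k} v`. Cayley–Hamilton gives `f_{n+1} = 0`, and the `f_k` form a basis exactly when `v` is a
cyclic vector of `B`. In that case `B` is, in this basis, the nilpotent shift minus `v ⊗ l`, and
`l(v) = c_n = 0` because the trace is zero. Hence the jet is a translate of the single jet
`standardJet` (`mk_smul_standardJet`), whose stabilizer is trivial (`stabilizer_standardJet`). If
`v` is not cyclic, a row eigenvector `m` of `B` with `m(v) = 0` and a column eigenvector `u` for the
same eigenvalue give a non-scalar matrix `1 + u ⊗ m` that fixes `v` and commutes with `B`, so the
isotropy is not trivial. Therefore `G⁰` is one orbit, cut out in each chart by the non-vanishing of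
the polynomial `det (f₀, …, fₙ)`.

The orbit map is regular since `A⁻¹` is the adjugate on `SL`. Its inverse sends a jet to the class
of `a • M`, where `M` is polynomial in the coordinates and `a ^ (n + 1) * det M = 1`. The scalar `a`
is not rational, but a polynomial in the entries of `a • M` is `∑ a^r p_r` with `r ≤ n` and `p_r`
rational, and the `p_r` are determined by the values at the `n + 1` roots `a`. Comparing
coefficients eliminates `a` (`isMorphismAt_pslVariety`). -/

noncomputable section

open scoped Manifold ContDiff LinearAlgebra.Projectivization

namespace ProlongedProj

variable {n : ℕ}

/-! ### Jets of vector fields are determined by their chart coordinates. -/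

section Manifolds

open Filter Topology

variable {E : Type*} [NormedAddCommGroup E] [NormedSpace ℂ E]
  {M : Type*} [TopologicalSpace M] [ChartedSpace E M]
  {F : Type*} [NormedAddCommGroup F] [NormedSpace ℂ F]
  {N : Type*} [TopologicalSpace N] [ChartedSpace F N]

theorem tangentMap_congr_of_eventuallyEq {f g : M → N} {v : TangentBundle 𝓘(ℂ, E) M}
    (h : f =ᶠ[𝓝 v.proj] g) :
    tangentMap 𝓘(ℂ, E) 𝓘(ℂ, F) f v = tangentMap 𝓘(ℂ, E) 𝓘(ℂ, F) g v := by
  have h1 : f v.proj = g v.proj := h.eq_of_nhds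
  have h2 : mfderiv 𝓘(ℂ, E) 𝓘(ℂ, F) f v.proj = mfderiv 𝓘(ℂ, E) 𝓘(ℂ, F) g v.proj := h.mfderiv_eq
  refine Bundle.TotalSpace.ext h1 ?_
  refine heq_of_eq ?_
  exact congrArg (fun L : E →L[ℂ] F => L v.2) h2

/-- On an open set the derivative within the set is the derivative, so smoothness passes from
`tangentMapWithin` to `tangentMap`. -/
theorem contMDiffAt_tangentMap_of_isOpen [IsManifold 𝓘(ℂ, E) ω M] [IsManifold 𝓘(ℂ, F) ω N]
    {f : M → N} {s : Set M} (hs : IsOpen s)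
    (hf : ContMDiffOn 𝓘(ℂ, E) 𝓘(ℂ, F) ω f s) {v : TangentBundle 𝓘(ℂ, E) M} (hv : v.proj ∈ s) :
    ContMDiffAt 𝓘(ℂ, E).tangent 𝓘(ℂ, F).tangent ω (tangentMap 𝓘(ℂ, E) 𝓘(ℂ, F) f) v := by
  have h1 := hf.contMDiffOn_tangentMapWithin (m := ω) le_rfl hs.uniqueMDiffOn
  have hopen : IsOpen (Bundle.TotalSpace.proj ⁻¹' s : Set (TangentBundle 𝓘(ℂ, E) M)) :=
    hs.preimage (FiberBundle.continuous_proj E _)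
  refine (h1.contMDiffAt (hopen.mem_nhds hv)).congr_of_eventuallyEq ?_
  filter_upwards [hopen.mem_nhds hv] with p hp
  exact (tangentMapWithin_eq_tangentMap (hs.uniqueMDiffOn _ hp)
    ((hf.contMDiffAt (hs.mem_nhds hp)).mdifferentiableAt omega_ne_zero)).symm


/-- The tangent vector `v` at the point `u` of a vector space. -/
def vectorAt (u v : E) : TangentBundle 𝓘(ℂ, E) E := ⟨u, v⟩

/-- The vector field with components `c` on a vector space. -/
def fieldOf (c : E → E) (u : E) : TangentBundle 𝓘(ℂ, E) E := vectorAt u (c u)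

theorem contMDiffAt_fieldOf {c : E → E} {u : E} (hc : ContDiffAt ℂ ω c u) :
    ContMDiffAt 𝓘(ℂ, E) 𝓘(ℂ, E).tangent ω (fieldOf c) u :=
  contMDiffAt_vectorSpace_iff_contDiffAt.2 hc

/-- Under the identification of `TE` with `E × E` the field is `u ↦ (u, c u)`, and its differential
involves `c` only through its value and its derivative at the point. -/
theorem tangentMap_fieldOf_congr {c c' : E → E} {v : TangentBundle 𝓘(ℂ, E) E}
    (hc : DifferentiableAt ℂ c v.proj) (hc' : DifferentiableAt ℂ c' v.proj)
    (h0 : c v.proj = c' v.proj) (h1 : fderiv ℂ c v.proj = fderiv ℂ c' v.proj) :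
    tangentMap 𝓘(ℂ, E) 𝓘(ℂ, E).tangent (fieldOf c) v =
      tangentMap 𝓘(ℂ, E) 𝓘(ℂ, E).tangent (fieldOf c') v := by
  have key : ∀ c : E → E, DifferentiableAt ℂ c v.proj →
      tangentMap 𝓘(ℂ, E) 𝓘(ℂ, E).tangent (fieldOf c) v =
      tangentMap 𝓘(ℂ, E).tangent 𝓘(ℂ, E).tangent
        (tangentBundleModelSpaceHomeomorph 𝓘(ℂ, E)).symm
        (⟨(v.proj, c v.proj), (v.2, fderiv ℂ c v.proj v.2)⟩) := by
    intro c hc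
    have hd : DifferentiableAt ℂ (fun u : E => (u, c u)) v.proj := differentiableAt_id.prodMk hc
    have hpair : MDifferentiableAt 𝓘(ℂ, E) 𝓘(ℂ, E × E) (fun u : E => (u, c u)) v.proj :=
      hd.mdifferentiableAt
    have hval : (mfderiv 𝓘(ℂ, E) 𝓘(ℂ, E × E) (fun u : E => (u, c u)) v.proj v.2 : E × E) =
        (v.2, fderiv ℂ c v.proj v.2) := by
      rw [mfderiv_eq_fderiv, DifferentiableAt.fderiv_prodMk differentiableAt_fun_id hc,
        fderiv_fun_id]
      rfl
    rw [modelWithCornersSelf_prod] at hpair hval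
    have hh : ContMDiff 𝓘(ℂ, E).tangent 𝓘(ℂ, E).tangent 1
      ((tangentBundleModelSpaceHomeomorph 𝓘(ℂ, E)).symm :
        ModelProd E E → TangentBundle 𝓘(ℂ, E) E) :=
      contMDiff_tangentBundleModelSpaceHomeomorph_symm
    have e : (fieldOf c) =
      ((tangentBundleModelSpaceHomeomorph 𝓘(ℂ, E)).symm : ModelProd E E → TangentBundle 𝓘(ℂ, E) E) ∘
       fun u : E => ((u, c u) : ModelProd E E) := rfl
    rw [e, tangentMap_comp_at v (hh.mdifferentiableAt one_ne_zero) hpair]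
    congr 1
    exact Bundle.TotalSpace.ext rfl (heq_of_eq hval)
  rw [key c hc, key c' hc', h0, h1]

variable [IsManifold 𝓘(ℂ, E) ω M]

theorem contMDiffOn_atlas {e : OpenPartialHomeomorph M E} (he : e ∈ atlas E M) :
    ContMDiffOn 𝓘(ℂ, E) 𝓘(ℂ, E) ω e e.source :=
  contMDiffOn_of_mem_maximalAtlas (IsManifold.subset_maximalAtlas he)

theorem contMDiffOn_atlas_symm {e : OpenPartialHomeomorph M E} (he : e ∈ atlas E M) :
    ContMDiffOn 𝓘(ℂ, E) 𝓘(ℂ, E) ω e.symm e.target :=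
  contMDiffOn_symm_of_mem_maximalAtlas (IsManifold.subset_maximalAtlas he)

theorem contMDiffAt_atlas {e : OpenPartialHomeomorph M E} (he : e ∈ atlas E M) {x : M}
    (hx : x ∈ e.source) : ContMDiffAt 𝓘(ℂ, E) 𝓘(ℂ, E) ω e x :=
  (contMDiffOn_atlas he).contMDiffAt (e.open_source.mem_nhds hx)

theorem contMDiffAt_atlas_symm {e : OpenPartialHomeomorph M E} (he : e ∈ atlas E M) {u : E}
    (hu : u ∈ e.target) : ContMDiffAt 𝓘(ℂ, E) 𝓘(ℂ, E) ω e.symm u :=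
  (contMDiffOn_atlas_symm he).contMDiffAt (e.open_target.mem_nhds hu)

theorem tangentMap_symm_tangentMap {e : OpenPartialHomeomorph M E} (he : e ∈ atlas E M)
    {v : TangentBundle 𝓘(ℂ, E) M} (hv : v.proj ∈ e.source) :
    tangentMap 𝓘(ℂ, E) 𝓘(ℂ, E) e.symm (tangentMap 𝓘(ℂ, E) 𝓘(ℂ, E) e v) = v := by
  rw [← tangentMap_comp_at v
    ((contMDiffAt_atlas_symm he (e.map_source hv)).mdifferentiableAt omega_ne_zero)
    ((contMDiffAt_atlas he hv).mdifferentiableAt omega_ne_zero)]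
  have h : e.symm ∘ e =ᶠ[𝓝 v.proj] id := by
    filter_upwards [e.open_source.mem_nhds hv] with x hx using e.left_inv hx
  rw [tangentMap_congr_of_eventuallyEq h, tangentMap_id]
  rfl

/-- A vector field is recovered from its components in a chart. -/
theorem eq_tangentMap_symm_components {e : OpenPartialHomeomorph M E} (he : e ∈ atlas E M)
    {s : M → TangentBundle 𝓘(ℂ, E) M} (hs : ∀ x, (s x).proj = x) {x : M} (hx : x ∈ e.source) :
    s x = tangentMap 𝓘(ℂ, E) 𝓘(ℂ, E) e.symm (fieldOf (components e s) (e x)) := by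
  have h : fieldOf (components e s) (e x) =
      tangentMap 𝓘(ℂ, E) 𝓘(ℂ, E) e (s x) := by
    refine Bundle.TotalSpace.ext (congrArg e (hs x).symm) (heq_of_eq ?_)
    change (tangentMap 𝓘(ℂ, E) 𝓘(ℂ, E) e (s (e.symm (e x)))).2 = _
    rw [e.left_inv hx]
  rw [h, tangentMap_symm_tangentMap he]
  rwa [hs]

theorem contDiffAt_components {e : OpenPartialHomeomorph M E} (he : e ∈ atlas E M)
    (s : VectorFieldGerm E M) (hs : s.base ∈ e.source) :
    ContDiffAt ℂ ω (components e s.toFun) (e s.base) := by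
  have hsnd : ContMDiff (𝓘(ℂ, E).tangent) 𝓘(ℂ, E) ω
      (fun p : TangentBundle 𝓘(ℂ, E) E => (p.2 : E)) :=
    contMDiff_snd_tangentBundle_modelSpace E 𝓘(ℂ, E)
  have hs' : ContMDiffAt 𝓘(ℂ, E) (𝓘(ℂ, E).tangent) ω s.toFun (e.symm (e s.base)) := by
    rw [e.left_inv hs]; exact s.holomorphic
  have hF := contMDiffAt_tangentMap_of_isOpen e.open_source (contMDiffOn_atlas he)
    (v := s.toFun (e.symm (e s.base))) (by rwa [s.proj_toFun, e.left_inv hs])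
  rw [← contMDiffAt_iff_contDiffAt]
  exact hsnd.contMDiffAt.comp _ (ContMDiffAt.comp (e s.base) hF
    (ContMDiffAt.comp (e s.base) hs' (contMDiffAt_atlas_symm he (e.map_source hs))))

/-- The 1-jet of a vector field is determined by its coordinates in a chart. -/
theorem sameJet_of_germCoord_eq {e : OpenPartialHomeomorph M E} (he : e ∈ atlas E M)
    {s t : VectorFieldGerm E M} (hs : s.base ∈ e.source) (ht : t.base ∈ e.source)
    (h : germCoord e s = germCoord e t) : s.SameJet t := by
  rw [germCoord, germCoord, if_pos hs, if_pos ht, Prod.mk.injEq, Prod.mk.injEq] at h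
  obtain ⟨h0, h1, h2⟩ := h
  have hb : s.base = t.base := e.injOn hs ht h0
  refine ⟨hb, fun v hv => ?_⟩
  -- Near its base point a field is `de⁻¹ ∘ fieldOf (components) ∘ e`. By the chain rule its
  -- differential depends on the germ only through the differential of the middle factor.
  have key : ∀ r : VectorFieldGerm E M, r.base ∈ e.source → v.proj = r.base →
      tangentMap 𝓘(ℂ, E) 𝓘(ℂ, E).tangent r.toFun v =
      tangentMap 𝓘(ℂ, E).tangent 𝓘(ℂ, E).tangent (tangentMap 𝓘(ℂ, E) 𝓘(ℂ, E) e.symm)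
        (tangentMap 𝓘(ℂ, E) 𝓘(ℂ, E).tangent
          (fieldOf (components e r.toFun))
          (tangentMap 𝓘(ℂ, E) 𝓘(ℂ, E) e v)) := by
    intro r hr hvr
    have hv' : v.proj ∈ e.source := hvr ▸ hr
    have hsec : ContMDiffAt 𝓘(ℂ, E) 𝓘(ℂ, E).tangent ω
        (fieldOf (components e r.toFun)) (e v.proj) := by
      rw [hvr]; exact contMDiffAt_fieldOf (contDiffAt_components he r hr)
    have he' := contMDiffAt_atlas he hv'
    have hes := contMDiffAt_tangentMap_of_isOpen e.open_target (contMDiffOn_atlas_symm he)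
      (v := fieldOf (components e r.toFun) (e v.proj)) (e.map_source hv')
    have hev : r.toFun =ᶠ[𝓝 v.proj] (tangentMap 𝓘(ℂ, E) 𝓘(ℂ, E) e.symm) ∘
        ((fieldOf (components e r.toFun)) ∘ e) := by
      filter_upwards [e.open_source.mem_nhds hv'] with x hx
      exact eq_tangentMap_symm_components he r.proj_toFun hx
    have h3 := hev.mfderiv_eq (I := 𝓘(ℂ, E)) (I' := 𝓘(ℂ, E).tangent)
    have h4 : tangentMap 𝓘(ℂ, E) 𝓘(ℂ, E).tangent r.toFun v =
        tangentMap 𝓘(ℂ, E) 𝓘(ℂ, E).tangent ((tangentMap 𝓘(ℂ, E) 𝓘(ℂ, E) e.symm) ∘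
        ((fieldOf (components e r.toFun)) ∘ e)) v := by
      refine Bundle.TotalSpace.ext hev.eq_of_nhds (heq_of_eq ?_)
      exact congrArg (fun L : E →L[ℂ] E × E => L v.2) h3
    rw [h4, tangentMap_comp_at v (hes.mdifferentiableAt omega_ne_zero)
      ((hsec.comp _ he').mdifferentiableAt omega_ne_zero),
      tangentMap_comp_at v (hsec.mdifferentiableAt omega_ne_zero)
        (he'.mdifferentiableAt omega_ne_zero)]
  rw [key s hs hv, key t ht (hv.trans hb)]
  congr 1
  have hev : (tangentMap 𝓘(ℂ, E) 𝓘(ℂ, E) e v).proj = e s.base := congrArg e hv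
  have hev' : (tangentMap 𝓘(ℂ, E) 𝓘(ℂ, E) e v).proj = e t.base := hev.trans h0
  refine tangentMap_fieldOf_congr ?_ ?_ ?_ ?_
  · rw [hev]; exact (contDiffAt_components he s hs).differentiableAt omega_ne_zero
  · rw [hev']; exact (contDiffAt_components he t ht).differentiableAt omega_ne_zero
  · rw [hev, h1, h0]
  · rw [hev, h2, h0]

theorem jetCoord_injOn {e : OpenPartialHomeomorph M E} (he : e ∈ atlas E M)
    {p q : SecondProlongation E M} (hp : p.base ∈ e.source) (hq : q.base ∈ e.source)
    (h : jetCoord e he p = jetCoord e he q) : p = q := by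
  induction p using Quotient.inductionOn with | _ s
  induction q using Quotient.inductionOn with | _ t
  exact Quotient.sound (sameJet_of_germCoord_eq he hp hq h)

end Manifolds

/-! ### Vector fields on projective space induced by linear fields. -/

section LinearFields

open Filter Topology Matrix

theorem smul_mk_eq {a : ℂ} (ha : a ≠ 0) {v : Fin (n + 1) → ℂ} (hv : v ≠ 0) :
    Projectivization.mk ℂ (a • v) (smul_ne_zero ha hv) = Projectivization.mk ℂ v hv :=
  (Projectivization.mk_eq_mk_iff' ℂ _ _ _ _).2 ⟨a, rfl⟩

open Classical in
/-- The projection `ℂⁿ⁺¹ → ℙⁿ`, extended by an arbitrary value at the origin. -/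
def toProj (v : Fin (n + 1) → ℂ) : ProjSpace n :=
  if h : v ≠ 0 then Projectivization.mk ℂ v h
  else Projectivization.mk ℂ (Pi.single 0 1) (by simp)

theorem toProj_of_ne {v : Fin (n + 1) → ℂ} (hv : v ≠ 0) :
    toProj v = Projectivization.mk ℂ v hv := dif_pos hv

theorem toProj_rep (p : ProjSpace n) : toProj p.rep = p := by
  rw [toProj_of_ne p.rep_nonzero, p.mk_rep]

theorem toProj_smul {a : ℂ} (ha : a ≠ 0) (v : Fin (n + 1) → ℂ) : toProj (a • v) = toProj v := by
  by_cases hv : v = 0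
  · simp [hv]
  · rw [toProj_of_ne hv, toProj_of_ne (smul_ne_zero ha hv), smul_mk_eq ha hv]

theorem exists_rep_toProj {v : Fin (n + 1) → ℂ} (hv : v ≠ 0) :
    ∃ a : ℂ, a ≠ 0 ∧ (toProj v).rep = a • v := by
  rw [toProj_of_ne hv]; exact rep_mk v hv

theorem toProj_mem_source_iff (i : Fin (n + 1)) {v : Fin (n + 1) → ℂ} (hv : v ≠ 0) :
    toProj v ∈ (affineChart i).source ↔ v i ≠ 0 := by
  rw [toProj_of_ne hv]; exact rep_mk_ne_zero_iff i v hv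

theorem affineCoord_toProj (i : Fin (n + 1)) {v : Fin (n + 1) → ℂ} (hv : v ≠ 0) :
    affineCoord i (toProj v) = fun j => v (i.succAbove j) / v i := by
  rw [toProj_of_ne hv]; exact affineCoord_mk i v hv

/-- The representative, with `i`-th coordinate `1`, of the point with affine coordinates `y`. -/
def affineRep (i : Fin (n + 1)) (y : Fin n → ℂ) : Fin (n + 1) → ℂ := i.insertNth (1 : ℂ) y

@[simp] theorem affineRep_same (i : Fin (n + 1)) (y : Fin n → ℂ) : affineRep i y i = 1 := by
  simp [affineRep]

@[simp] theorem affineRep_succAbove (i : Fin (n + 1)) (y : Fin n → ℂ) (j : Fin n) :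
    affineRep i y (i.succAbove j) = y j := by
  simp [affineRep]

theorem affineRep_ne_zero (i : Fin (n + 1)) (y : Fin n → ℂ) : affineRep i y ≠ 0 := fun h => by
  simpa using congrFun h i

theorem affineRep_ratio (i : Fin (n + 1)) {v : Fin (n + 1) → ℂ} (hv : v i ≠ 0) :
    affineRep i (fun j => v (i.succAbove j) / v i) = (v i)⁻¹ • v := by
  funext k
  refine Fin.succAboveCases i ?_ (fun j => ?_) k
  · simp [hv]
  · simp [div_eq_inv_mul]

theorem toProj_affineRep (i : Fin (n + 1)) (y : Fin n → ℂ) :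
    toProj (affineRep i y) = (affineChart i).symm y := toProj_of_ne (affineRep_ne_zero i y)

theorem contDiff_affineRep (i : Fin (n + 1)) : ContDiff ℂ ω (affineRep (n := n) i) :=
  contDiff_pi.2 fun k => contDiff_insertNth i k

theorem affineChart_mem_atlas (i : Fin (n + 1)) :
    affineChart i ∈ atlas (Fin n → ℂ) (ProjSpace n) := Set.mem_range_self i

/-- The affine coordinates `v_j / v_i` as a function on `ℂⁿ⁺¹`. -/
def ratio (i : Fin (n + 1)) (v : Fin (n + 1) → ℂ) : Fin n → ℂ := fun j => v (i.succAbove j) / v i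

theorem contDiffAt_ratio (i : Fin (n + 1)) {v : Fin (n + 1) → ℂ} (hv : v i ≠ 0) :
    ContDiffAt ℂ ω (ratio i) v :=
  contDiffAt_pi.2 fun _ =>
    (contDiff_apply ℂ ℂ _).contDiffAt.div (contDiff_apply ℂ ℂ _).contDiffAt hv

theorem ne_zero_of_apply_ne_zero {i : Fin (n + 1)} {v : Fin (n + 1) → ℂ} (hv : v i ≠ 0) : v ≠ 0 :=
  fun h => hv (congrFun h i)

theorem isOpen_apply_ne_zero (i : Fin (n + 1)) : IsOpen {v : Fin (n + 1) → ℂ | v i ≠ 0} :=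
  isOpen_ne_fun (continuous_apply i) continuous_const

theorem toProj_eq_symm_ratio (i : Fin (n + 1)) {v : Fin (n + 1) → ℂ} (hv : v i ≠ 0) :
    toProj v = (affineChart i).symm (ratio i v) := by
  rw [← toProj_affineRep]
  unfold ratio
  rw [affineRep_ratio i hv, toProj_smul (inv_ne_zero hv)]

/-- Where the `i`-th coordinate is non-zero, the projection is the inverse affine chart composed
with the coordinate quotients. -/
theorem contMDiffOn_toProj :
    ContMDiffOn 𝓘(ℂ, Fin (n + 1) → ℂ) 𝓘(ℂ, Fin n → ℂ) ω (toProj (n := n)) {v | v ≠ 0} := by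
  intro v hv
  obtain ⟨i, hi⟩ : ∃ i, v i ≠ 0 := by
    by_contra! h
    exact hv (funext h)
  refine ContMDiffAt.contMDiffWithinAt ?_
  have h1 : ContMDiffAt 𝓘(ℂ, Fin n → ℂ) 𝓘(ℂ, Fin n → ℂ) ω (affineChart i).symm (ratio i v) :=
    contMDiffAt_atlas_symm (affineChart_mem_atlas i) trivial
  refine (h1.comp v (contDiffAt_ratio i hi).contMDiffAt).congr_of_eventuallyEq ?_
  filter_upwards [(isOpen_apply_ne_zero i).mem_nhds hi] with w hw
  exact toProj_eq_symm_ratio i hw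

theorem isOpen_ne_zero : IsOpen {v : Fin (n + 1) → ℂ | v ≠ 0} := isOpen_ne

theorem mdifferentiableAt_toProj {v : Fin (n + 1) → ℂ} (hv : v ≠ 0) :
    MDifferentiableAt 𝓘(ℂ, Fin (n + 1) → ℂ) 𝓘(ℂ, Fin n → ℂ) (toProj (n := n)) v :=
  (contMDiffOn_toProj.contMDiffAt (isOpen_ne_zero.mem_nhds hv)).mdifferentiableAt omega_ne_zero

/-- The derivative of the projection `ℂⁿ⁺¹ → ℙⁿ`. -/
def tangentProj (x v : Fin (n + 1) → ℂ) : TangentBundle 𝓘(ℂ, Fin n → ℂ) (ProjSpace n) :=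
  tangentMap 𝓘(ℂ, Fin (n + 1) → ℂ) 𝓘(ℂ, Fin n → ℂ) toProj (vectorAt x v)

theorem tangentMap_vectorAt {E F : Type*} [NormedAddCommGroup E] [NormedSpace ℂ E]
    [NormedAddCommGroup F] [NormedSpace ℂ F] (f : E → F) (x v : E) :
    tangentMap 𝓘(ℂ, E) 𝓘(ℂ, F) f (vectorAt x v) = vectorAt (f x) (fderiv ℂ f x v) := by
  refine Bundle.TotalSpace.ext rfl (heq_of_eq ?_)
  change mfderiv 𝓘(ℂ, E) 𝓘(ℂ, F) f x v = _
  rw [mfderiv_eq_fderiv]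
  rfl

theorem tangentMap_mulVec (A : Matrix (Fin (n + 1)) (Fin (n + 1)) ℂ) (x v : Fin (n + 1) → ℂ) :
    tangentMap 𝓘(ℂ, Fin (n + 1) → ℂ) 𝓘(ℂ, Fin (n + 1) → ℂ) (fun x => A *ᵥ x) (vectorAt x v) =
      vectorAt (A *ᵥ x) (A *ᵥ v) := by
  rw [tangentMap_vectorAt]
  congr 1
  have : (fun x => A *ᵥ x) = (LinearMap.toContinuousLinearMap A.mulVecLin :
    (Fin (n + 1) → ℂ) →L[ℂ] _) := rfl
  rw [this, ContinuousLinearMap.fderiv]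
  rfl

theorem mdifferentiableAt_mulVec (A : Matrix (Fin (n + 1)) (Fin (n + 1)) ℂ) (x : Fin (n + 1) → ℂ) :
    MDifferentiableAt 𝓘(ℂ, Fin (n + 1) → ℂ) 𝓘(ℂ, Fin (n + 1) → ℂ) (fun x => A *ᵥ x) x :=
  (LinearMap.toContinuousLinearMap A.mulVecLin).differentiableAt.mdifferentiableAt

/-- Differentiate the invariance of the projection under the homothety of ratio `a`. This makes the
field induced by `x ↦ B x` independent of the representative of the point. -/
theorem tangentProj_smul {a : ℂ} (ha : a ≠ 0) {x : Fin (n + 1) → ℂ} (hx : x ≠ 0)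
    (v : Fin (n + 1) → ℂ) : tangentProj (a • x) (a • v) = tangentProj x v := by
  have h1 := tangentMap_mulVec (a • (1 : Matrix (Fin (n + 1)) (Fin (n + 1)) ℂ)) x v
  simp only [smul_mulVec, one_mulVec] at h1
  have h2 := mdifferentiableAt_toProj (smul_ne_zero ha hx)
  rw [tangentProj, tangentProj, ← h1, ← tangentMap_comp_at]
  · congr 1
    funext x
    exact toProj_smul ha x
  · exact h2
  · have := mdifferentiableAt_mulVec (a • (1 : Matrix (Fin (n + 1)) (Fin (n + 1)) ℂ)) x
    simp only [smul_mulVec, one_mulVec] at this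
    exact this

/-- The vector field on `ℙⁿ` induced by the linear vector field `x ↦ B x` on `ℂⁿ⁺¹`. -/
def linearField (B : Matrix (Fin (n + 1)) (Fin (n + 1)) ℂ) (p : ProjSpace n) :
    TangentBundle 𝓘(ℂ, Fin n → ℂ) (ProjSpace n) := tangentProj p.rep (B *ᵥ p.rep)

theorem linearField_toProj (B : Matrix (Fin (n + 1)) (Fin (n + 1)) ℂ) {x : Fin (n + 1) → ℂ}
    (hx : x ≠ 0) : linearField B (toProj x) = tangentProj x (B *ᵥ x) := by
  obtain ⟨a, ha, h⟩ := exists_rep_toProj hx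
  rw [linearField, h, mulVec_smul, tangentProj_smul ha hx]

/-- The representative `p.rep` is an arbitrary choice with no continuity in `p`. On a chart it is
replaced by the holomorphic section `affineRep i`, along which the field is a composite of
holomorphic maps. -/
theorem contMDiff_linearField (B : Matrix (Fin (n + 1)) (Fin (n + 1)) ℂ) :
    ContMDiff 𝓘(ℂ, Fin n → ℂ) 𝓘(ℂ, Fin n → ℂ).tangent ω (linearField B) := by
  intro p
  obtain ⟨i, hi⟩ := exists_rep_ne_zero p
  have h1 := contMDiffAt_tangentMap_of_isOpen isOpen_ne_zero (contMDiffOn_toProj (n := n))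
    (v := fieldOf (fun x => B *ᵥ x) (affineRep i (affineChart i p)))
    (affineRep_ne_zero _ _)
  have h2 : ContMDiffAt 𝓘(ℂ, Fin (n + 1) → ℂ) 𝓘(ℂ, Fin (n + 1) → ℂ).tangent ω
      (fieldOf (fun x => B *ᵥ x)) (affineRep i (affineChart i p)) :=
    contMDiffAt_fieldOf (LinearMap.toContinuousLinearMap B.mulVecLin).contDiff.contDiffAt
  have h3 : ContMDiffAt 𝓘(ℂ, Fin n → ℂ) 𝓘(ℂ, Fin (n + 1) → ℂ) ω (affineRep i) (affineChart i p) :=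
    (contDiff_affineRep i).contDiffAt.contMDiffAt
  have h4 := contMDiffAt_atlas (affineChart_mem_atlas i) hi
  refine (ContMDiffAt.comp p h1 (ContMDiffAt.comp p h2
    (ContMDiffAt.comp p h3 h4))).congr_of_eventuallyEq ?_
  filter_upwards [(affineChart i).open_source.mem_nhds hi] with q hq
  conv_lhs => rw [← (affineChart i).left_inv hq, ← toProj_affineRep,
    linearField_toProj B (affineRep_ne_zero _ _)]
  rfl

/-- The germ at `p` of the vector field on `ℙⁿ` induced by `x ↦ B x`. -/
def linearGerm (p : ProjSpace n) (B : Matrix (Fin (n + 1)) (Fin (n + 1)) ℂ) :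
    VectorFieldGerm (Fin n → ℂ) (ProjSpace n) where
  base := p
  toFun := linearField B
  proj_toFun := toProj_rep
  holomorphic := contMDiff_linearField B p

/-- The 1-jet at `[v]` of the vector field on `ℙⁿ` induced by `x ↦ B x`. -/
def linearJet (v : Fin (n + 1) → ℂ) (B : Matrix (Fin (n + 1)) (Fin (n + 1)) ℂ) :
    ProjProlongation n := jet (linearGerm (toProj v) B)

theorem mulVec_ne_zero (A : Matrix.SpecialLinearGroup (Fin (n + 1)) ℂ) {v : Fin (n + 1) → ℂ}
    (hv : v ≠ 0) : A.1 *ᵥ v ≠ 0 := (mk_smul_mk A v hv).choose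

theorem mk_smul_toProj (A : Matrix.SpecialLinearGroup (Fin (n + 1)) ℂ) {v : Fin (n + 1) → ℂ}
    (hv : v ≠ 0) : (QuotientGroup.mk A : PSL n) • toProj v = toProj (A.1 *ᵥ v) := by
  rw [toProj_of_ne hv, toProj_of_ne (mulVec_ne_zero A hv)]
  exact (mk_smul_mk A v hv).choose_spec

theorem tangentMap_leftTranslation (A : Matrix.SpecialLinearGroup (Fin (n + 1)) ℂ)
    {x : Fin (n + 1) → ℂ} (hx : x ≠ 0) (v : Fin (n + 1) → ℂ) :
    tangentMap 𝓘(ℂ, Fin n → ℂ) 𝓘(ℂ, Fin n → ℂ) (leftTranslation (QuotientGroup.mk A : PSL n))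
      (tangentProj x v) = tangentProj (A.1 *ᵥ x) (A.1 *ᵥ v) := by
  have h2 := mdifferentiableAt_toProj (mulVec_ne_zero A hx)
  rw [tangentProj, tangentProj, ← tangentMap_mulVec, ← tangentMap_comp_at, ← tangentMap_comp_at]
  · refine tangentMap_congr_of_eventuallyEq ?_
    filter_upwards [isOpen_ne_zero.mem_nhds hx] with y hy
    exact mk_smul_toProj A hy
  · exact h2
  · exact mdifferentiableAt_mulVec _ _
  · exact (leftTranslation _).contMDiff_toFun.contMDiffAt.mdifferentiableAt omega_ne_zero
  · exact mdifferentiableAt_toProj hx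

/-- The linear map `A` lifts the translation, and it carries the field `x ↦ B x` on `ℂⁿ⁺¹` to `x ↦ A
B A⁻¹ x`; projecting gives the equality of the germs themselves. It reduces the study of the action
to conjugation. -/
theorem mk_smul_linearJet (A : Matrix.SpecialLinearGroup (Fin (n + 1)) ℂ) {v : Fin (n + 1) → ℂ}
    (hv : v ≠ 0) (B : Matrix (Fin (n + 1)) (Fin (n + 1)) ℂ) :
    (QuotientGroup.mk A : PSL n) • linearJet v B =
      linearJet (A.1 *ᵥ v) (A.1 * B * (A⁻¹).1) := by
  refine congrArg jet (VectorFieldGerm.ext' (mk_smul_toProj A hv) (funext fun p => ?_))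
  change tangentMap 𝓘(ℂ, Fin n → ℂ) 𝓘(ℂ, Fin n → ℂ) (leftTranslation (QuotientGroup.mk A : PSL n))
    (linearField B ((QuotientGroup.mk A : PSL n)⁻¹ • p)) = linearField _ p
  have h1 : (QuotientGroup.mk A : PSL n)⁻¹ • p = toProj ((A⁻¹).1 *ᵥ p.rep) := by
    rw [← mk_smul_toProj _ p.rep_nonzero, toProj_rep]
    rfl
  have h2 : A.1 * (A⁻¹).1 = 1 := congrArg Subtype.val (mul_inv_cancel A)
  rw [h1, linearField_toProj _ (mulVec_ne_zero _ p.rep_nonzero),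
    tangentMap_leftTranslation A (mulVec_ne_zero _ p.rep_nonzero)]
  simp only [mulVec_mulVec, h2, one_mulVec, ← mul_assoc, linearField]

theorem linearJet_smul {a : ℂ} (ha : a ≠ 0) (v : Fin (n + 1) → ℂ)
    (B : Matrix (Fin (n + 1)) (Fin (n + 1)) ℂ) : linearJet (a • v) B = linearJet v B := by
  rw [linearJet, toProj_smul ha, linearJet]

/-- The components in the `i`-th affine chart of the vector field induced by `x ↦ B x`. -/
theorem components_linearField (i : Fin (n + 1)) (B : Matrix (Fin (n + 1)) (Fin (n + 1)) ℂ)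
    (u : Fin n → ℂ) : components (affineChart i) (linearField B) u = fun k =>
      (B *ᵥ affineRep i u) (i.succAbove k) - u k * (B *ᵥ affineRep i u) i := by
  have hi : affineRep i u i ≠ 0 := by simp
  have hx := affineRep_ne_zero i u
  have h1 : linearField B ((affineChart i).symm u) =
      tangentProj (affineRep i u) (B *ᵥ affineRep i u) := by
    rw [← toProj_affineRep, linearField_toProj B hx]
  have h2 : tangentMap 𝓘(ℂ, Fin n → ℂ) 𝓘(ℂ, Fin n → ℂ) (affineChart i)
      (tangentProj (affineRep i u) (B *ᵥ affineRep i u)) =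
      vectorAt (ratio i (affineRep i u))
        (fderiv ℂ (ratio i) (affineRep i u) (B *ᵥ affineRep i u)) := by
    rw [tangentProj, ← tangentMap_comp_at, ← tangentMap_vectorAt]
    · refine tangentMap_congr_of_eventuallyEq ?_
      filter_upwards [(isOpen_apply_ne_zero i).mem_nhds hi] with w hw
      exact affineCoord_toProj i (ne_zero_of_apply_ne_zero hw)
    · exact (contMDiffAt_atlas (affineChart_mem_atlas i)
        ((toProj_mem_source_iff i hx).2 hi)).mdifferentiableAt omega_ne_zero
    · exact mdifferentiableAt_toProj hx
  have h3 : components (affineChart i) (linearField B) u =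
      fderiv ℂ (ratio i) (affineRep i u) (B *ᵥ affineRep i u) := by
    have h4 := h1 ▸ h2
    exact congrArg (fun w : TangentBundle 𝓘(ℂ, Fin n → ℂ) (Fin n → ℂ) => (w.2 : Fin n → ℂ)) h4
  rw [h3]
  funext k
  -- Quotient rule for `v_k / v_i` at a point where `v_i = 1`.
  have h5 : HasFDerivAt (fun v : Fin (n + 1) → ℂ => v (i.succAbove k) * (v i)⁻¹) _
      (affineRep i u) :=
    (hasFDerivAt_apply (𝕜 := ℂ) (i.succAbove k) (affineRep i u)).mul
      (HasDerivAt.comp_hasFDerivAt (f := fun v : Fin (n + 1) → ℂ => v i) (affineRep i u)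
        (hasDerivAt_inv hi) (hasFDerivAt_apply (𝕜 := ℂ) i (affineRep i u)))
  have h6 := (contDiffAt_ratio i hi).differentiableAt omega_ne_zero
  have h7 := (hasFDerivAt_pi'.1 h6.hasFDerivAt k).unique h5
  have h8 := congrArg (fun L : (Fin (n + 1) → ℂ) →L[ℂ] ℂ => L (B *ᵥ affineRep i u)) h7
  refine h8.trans ?_
  simp
  ring

end LinearFields

/-! ### Coordinates of linear jets, and which matrices give the same jet. -/

section Coordinates

open Matrix

theorem affineRep_add_smul (i : Fin (n + 1)) (y : Fin n → ℂ) (t : ℂ) (j : Fin n) :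
    affineRep i (y + t • Pi.single j 1) = affineRep i y + t • Pi.single (i.succAbove j) 1 := by
  funext k
  refine Fin.succAboveCases i ?_ (fun l => ?_) k
  · simp
  · simp [Pi.single_apply]

/-- Along a coordinate line each component of a linear field has this form, the representative
`affineRep` being affine in the parameter. -/
theorem deriv_quadratic (a b c d e f : ℂ) :
    deriv (fun t : ℂ => (a + t * b) - (c + t * d) * (e + t * f)) 0 = b - (d * e + c * f) := by
  have h : ∀ a b : ℂ, HasDerivAt (fun t : ℂ => a + t * b) b 0 := fun a b => by
    simpa using ((hasDerivAt_id (0 : ℂ)).mul_const b).const_add a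
  have := ((h a b).sub ((h c d).mul (h e f))).deriv
  simp only [zero_mul, add_zero] at this
  exact this

/-- The natural coordinates of the 1-jet of the vector field induced by `x ↦ B x`. -/
theorem affineJetCoord_linearJet (i : Fin (n + 1)) {v : Fin (n + 1) → ℂ} (hv : v i ≠ 0)
    (B : Matrix (Fin (n + 1)) (Fin (n + 1)) ℂ) :
    affineJetCoord i (linearJet v B) =
      Sum.elim (ratio i v) (Sum.elim
        (fun k => (B *ᵥ affineRep i (ratio i v)) (i.succAbove k) -
          ratio i v k * (B *ᵥ affineRep i (ratio i v)) i)
        (fun jk => B (i.succAbove jk.2) (i.succAbove jk.1) -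
          ((if jk.2 = jk.1 then 1 else 0) * (B *ᵥ affineRep i (ratio i v)) i +
            ratio i v jk.2 * B i (i.succAbove jk.1)))) := by
  have hb : (linearGerm (toProj v) B).base ∈ (affineChart i).source :=
    (toProj_mem_source_iff i (ne_zero_of_apply_ne_zero hv)).2 hv
  have hc : (affineChart i) (toProj v) = ratio i v :=
    affineCoord_toProj i (ne_zero_of_apply_ne_zero hv)
  have hd : DifferentiableAt ℂ (components (affineChart i) (linearField B)) (ratio i v) := by
    rw [← hc]
    exact (contDiffAt_components (affineChart_mem_atlas i) (linearGerm (toProj v) B)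
      hb).differentiableAt omega_ne_zero
  have hj : jetCoord (affineChart i) (Set.mem_range_self i) (linearJet v B) =
      (ratio i v, components (affineChart i) (linearField B) (ratio i v),
        fderiv ℂ (components (affineChart i) (linearField B)) (ratio i v)) := by
    change germCoord _ (linearGerm (toProj v) B) = _
    rw [germCoord, if_pos hb, ← hc]
    rfl
  rw [affineJetCoord, hj]
  dsimp only
  congr 2
  · exact components_linearField i B _
  · funext jk
    obtain ⟨j, k⟩ := jk
    dsimp only
    rw [← hd.lineDeriv_eq_fderiv, ← deriv_quadratic ((B *ᵥ affineRep i (ratio i v)) (i.succAbove k))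
      _ (ratio i v k) _ ((B *ᵥ affineRep i (ratio i v)) i)]
    have h1 : DifferentiableAt ℂ (fun t : ℂ => components (affineChart i) (linearField B)
        (ratio i v + t • Pi.single j 1)) 0 := by
      refine DifferentiableAt.comp (0 : ℂ) (g := components (affineChart i) (linearField B)) ?_ ?_
      · simpa using hd
      · fun_prop
    rw [lineDeriv, deriv_pi (differentiableAt_pi.1 h1)]
    refine congrArg (fun f => deriv f 0) (funext fun t => ?_)
    rw [components_linearField, affineRep_add_smul, mulVec_add, mulVec_smul, mulVec_single_one]
    simp [Pi.single_apply]

/-- A linear vector field with prescribed 1-jet in the `i`-th affine chart. -/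
def jetMatrix (i : Fin (n + 1)) (c : Fin n ⊕ Fin n ⊕ Fin n × Fin n → ℂ) :
    Matrix (Fin (n + 1)) (Fin (n + 1)) ℂ :=
  i.insertNth (0 : Fin (n + 1) → ℂ) fun k =>
    i.insertNth (c (.inr (.inl k)) - ∑ j, c (.inr (.inr (j, k))) * c (.inl j))
      fun j => c (.inr (.inr (j, k)))

theorem jetMatrix_same (i : Fin (n + 1)) (c : Fin n ⊕ Fin n ⊕ Fin n × Fin n → ℂ) :
    jetMatrix i c i = 0 := by simp [jetMatrix]

theorem jetMatrix_succAbove_same (i : Fin (n + 1)) (c : Fin n ⊕ Fin n ⊕ Fin n × Fin n → ℂ)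
    (k : Fin n) : jetMatrix i c (i.succAbove k) i =
      c (.inr (.inl k)) - ∑ j, c (.inr (.inr (j, k))) * c (.inl j) := by simp [jetMatrix]

theorem jetMatrix_succAbove (i : Fin (n + 1)) (c : Fin n ⊕ Fin n ⊕ Fin n × Fin n → ℂ)
    (j k : Fin n) : jetMatrix i c (i.succAbove k) (i.succAbove j) = c (.inr (.inr (j, k))) := by
  simp [jetMatrix]

/-- The vector representing the point with the affine coordinates given by `c`. -/
def jetVector (i : Fin (n + 1)) (c : Fin n ⊕ Fin n ⊕ Fin n × Fin n → ℂ) : Fin (n + 1) → ℂ :=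
  affineRep i fun j => c (.inl j)

theorem jetVector_same (i : Fin (n + 1)) (c : Fin n ⊕ Fin n ⊕ Fin n × Fin n → ℂ) :
    jetVector i c i = 1 := affineRep_same _ _

theorem jetVector_ne_zero (i : Fin (n + 1)) (c : Fin n ⊕ Fin n ⊕ Fin n × Fin n → ℂ) :
    jetVector i c ≠ 0 := affineRep_ne_zero _ _

theorem ratio_affineRep (i : Fin (n + 1)) (y : Fin n → ℂ) : ratio i (affineRep i y) = y := by
  funext j; simp [ratio]

/-- As the `i`-th row of the matrix is zero, the quadratic terms of the field disappear and its
components are affine functions of `y`. Their linear part is `w`, and the constant term `z_k - ∑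
w_{jk} y_j` makes the value at the chosen point equal to `z`. -/
theorem affineJetCoord_jetMatrix (i : Fin (n + 1)) (c : Fin n ⊕ Fin n ⊕ Fin n × Fin n → ℂ) :
    affineJetCoord i (linearJet (jetVector i c) (jetMatrix i c)) = c := by
  rw [affineJetCoord_linearJet i (by simp [jetVector_same])]
  have h0 : ratio i (jetVector i c) = fun j => c (.inl j) := ratio_affineRep _ _
  have h1 : ∀ x, (jetMatrix i c *ᵥ x) i = 0 := fun x => by
    simp [mulVec, jetMatrix_same]
  funext m
  rw [h0, h1]
  obtain j | k | ⟨j, k⟩ := m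
  · rfl
  · simp [mulVec, dotProduct, Fin.sum_univ_succAbove _ i, jetMatrix_succAbove_same,
      jetMatrix_succAbove]
  · simp [jetMatrix_succAbove, jetMatrix_same]

theorem affineJetCoord_injOn (i : Fin (n + 1)) {p q : ProjProlongation n}
    (hp : p.base ∈ (affineChart i).source) (hq : q.base ∈ (affineChart i).source)
    (h : affineJetCoord i p = affineJetCoord i q) : p = q := by
  refine jetCoord_injOn (affineChart_mem_atlas i) hp hq (Prod.ext ?_ (Prod.ext ?_ ?_))
  · funext j; exact congrFun h (.inl j)
  · funext j; exact congrFun h (.inr (.inl j))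
  · refine ContinuousLinearMap.coe_injective ((Pi.basisFun ℂ (Fin n)).ext fun j => ?_)
    rw [Pi.basisFun_apply]
    funext k
    exact congrFun h (.inr (.inr (j, k)))

theorem jetVector_mem_source (i : Fin (n + 1)) (c : Fin n ⊕ Fin n ⊕ Fin n × Fin n → ℂ)
    (B : Matrix (Fin (n + 1)) (Fin (n + 1)) ℂ) :
    (linearJet (jetVector i c) B).base ∈ (affineChart i).source :=
  (toProj_mem_source_iff i (jetVector_ne_zero i c)).2 (by simp [jetVector_same])

/-- Both jets lie over the `i`-th chart and have the same coordinates there, so they coincide. -/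
theorem linearJet_affineJetCoord (i : Fin (n + 1)) {q : ProjProlongation n}
    (hq : q.base ∈ (affineChart i).source) :
    linearJet (jetVector i (affineJetCoord i q)) (jetMatrix i (affineJetCoord i q)) = q :=
  affineJetCoord_injOn i (jetVector_mem_source i _ _) hq (affineJetCoord_jetMatrix i _)

theorem exists_eq_linearJet (q : ProjProlongation n) :
    ∃ v B, v ≠ 0 ∧ q = linearJet v B := by
  obtain ⟨i, hi⟩ := exists_rep_ne_zero q.base
  exact ⟨_, _, jetVector_ne_zero i _, (linearJet_affineJetCoord i hi).symm⟩

/-- Adding a scalar matrix and a matrix `v ⊗ l` with `l(v) = 0` does not change the 1-jet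
at `[v]`. -/
theorem linearJet_add (v : Fin (n + 1) → ℂ) (hv : v ≠ 0) (B : Matrix (Fin (n + 1)) (Fin (n + 1)) ℂ)
    (a : ℂ) (l : Fin (n + 1) → ℂ) (hl : l ⬝ᵥ v = 0) :
    linearJet v (B + a • (1 : Matrix _ _ ℂ) + vecMulVec v l) = linearJet v B := by
  obtain ⟨i, hi⟩ : ∃ i, v i ≠ 0 := by
    by_contra! h
    exact hv (funext h)
  have hs : toProj v ∈ (affineChart i).source := (toProj_mem_source_iff i hv).2 hi
  refine affineJetCoord_injOn i hs hs ?_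
  rw [affineJetCoord_linearJet i hi, affineJetCoord_linearJet i hi]
  have hr : affineRep i (ratio i v) = (v i)⁻¹ • v := affineRep_ratio i hi
  -- Since `l(v) = 0`, the matrix `v ⊗ l` kills the representative of the point.
  have h1 : ∀ m, ((B + a • (1 : Matrix _ _ ℂ) + vecMulVec v l) *ᵥ affineRep i (ratio i v)) m =
      (B *ᵥ affineRep i (ratio i v)) m + a * affineRep i (ratio i v) m := by
    intro m
    rw [add_mulVec, add_mulVec, vecMulVec_mulVec, hr, dotProduct_smul, hl, smul_mulVec,
      one_mulVec]
    simp
  congr 2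
  · funext k
    rw [h1, h1]
    simp
    ring
  · funext jk
    obtain ⟨j, k⟩ := jk
    rw [h1]
    -- The two contributions of `v ⊗ l` to the derivative, `v_k l_j` and `(v_k / v_i) v_i l_j`,
    -- cancel.
    have h2 : ratio i v k * v i = v (i.succAbove k) := div_mul_cancel₀ _ hi
    have h3 : i ≠ i.succAbove j := (Fin.succAbove_ne i j).symm
    simp [vecMulVec_apply, one_apply, h3]
    split_ifs <;> linear_combination (-l (i.succAbove j)) * h2

/-- The converse of `linearJet_add` at the point `[1 : 0 : ⋯ : 0]`. -/
theorem exists_of_linearJet_eq {B B' : Matrix (Fin (n + 1)) (Fin (n + 1)) ℂ}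
    (h : linearJet (Pi.single 0 1) B = linearJet (Pi.single 0 1) B') :
    ∃ (a : ℂ) (l : Fin (n + 1) → ℂ), l 0 = 0 ∧
      B' = B + a • (1 : Matrix _ _ ℂ) + vecMulVec (Pi.single 0 1) l := by
  have h0 : (Pi.single 0 1 : Fin (n + 1) → ℂ) 0 ≠ 0 := by simp
  have hr : ratio 0 (Pi.single 0 1 : Fin (n + 1) → ℂ) = 0 := by
    funext j; simp [ratio]
  have hr' : affineRep 0 (0 : Fin n → ℂ) = Pi.single 0 1 := by
    rw [← hr]
    exact (affineRep_ratio 0 h0).trans (by simp)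
  have hc := congrArg (affineJetCoord 0) h
  rw [affineJetCoord_linearJet 0 h0, affineJetCoord_linearJet 0 h0, hr, hr', mulVec_single_one,
    mulVec_single_one] at hc
  have h1 : ∀ k : Fin n, B k.succ 0 = B' k.succ 0 := fun k => by
    simpa using congrFun hc (.inr (.inl k))
  have h2 : ∀ j k : Fin n, B k.succ j.succ - (if k = j then B 0 0 else 0) =
      B' k.succ j.succ - (if k = j then B' 0 0 else 0) := fun j k => by
    simpa using congrFun hc (.inr (.inr (j, k)))
  -- The scalar is read off the corner entry. The covector is the difference of the first rows, with
  -- the scalar part removed so that `l 0 = 0`.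
  refine ⟨B' 0 0 - B 0 0, fun j => B' 0 j - B 0 j - if j = 0 then B' 0 0 - B 0 0 else 0,
    by simp, ?_⟩
  ext k j
  refine Fin.cases ?_ (fun k => ?_) k
  · refine Fin.cases ?_ (fun j => ?_) j
    · simp [vecMulVec_apply]
    · simp [vecMulVec_apply, one_apply, (Fin.succ_ne_zero j).symm]
  · refine Fin.cases ?_ (fun j => ?_) j
    · simp [vecMulVec_apply, h1]
    · have := h2 j k
      by_cases hkj : k = j
      · simp [vecMulVec_apply, one_apply, hkj] at this ⊢
        linear_combination -this
      · simp [vecMulVec_apply, one_apply, hkj] at this ⊢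
        exact this.symm

end Coordinates

/-! ### Cyclic frames, isotropy groups and the open orbit. -/

section Frames

open Matrix

/-- The trace-free part of a matrix. -/
def traceFree (B : Matrix (Fin (n + 1)) (Fin (n + 1)) ℂ) : Matrix (Fin (n + 1)) (Fin (n + 1)) ℂ :=
  B + (-(B.trace / (n + 1))) • (1 : Matrix _ _ ℂ)

theorem trace_traceFree (B : Matrix (Fin (n + 1)) (Fin (n + 1)) ℂ) : (traceFree B).trace = 0 := by
  have : (n + 1 : ℂ) ≠ 0 := by exact_mod_cast n.succ_ne_zero
  simp only [traceFree, trace_add, trace_smul, trace_one, Fintype.card_fin, smul_eq_mul,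
    Nat.cast_add, Nat.cast_one]
  field_simp
  ring

/-- Scalar matrices do not affect jets, so every linear representative can be normalized to trace
zero. -/
theorem linearJet_traceFree {v : Fin (n + 1) → ℂ} (hv : v ≠ 0)
    (B : Matrix (Fin (n + 1)) (Fin (n + 1)) ℂ) : linearJet v (traceFree B) = linearJet v B := by
  have := linearJet_add v hv B (-(B.trace / (n + 1))) 0 (zero_dotProduct v)
  simpa [traceFree] using this

/-- The vectors obtained from `v` by applying the truncations of the characteristic polynomial
of `B`. -/
def frameVec (v : Fin (n + 1) → ℂ) (B : Matrix (Fin (n + 1)) (Fin (n + 1)) ℂ) (k : ℕ) :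
    Fin (n + 1) → ℂ :=
  ∑ j ∈ Finset.range (k + 1), B.charpoly.coeff (n + 1 - k + j) • ((B ^ j) *ᵥ v)

theorem natDegree_charpoly_fin (B : Matrix (Fin (n + 1)) (Fin (n + 1)) ℂ) :
    B.charpoly.natDegree = n + 1 := by simp

theorem frameVec_zero (v : Fin (n + 1) → ℂ) (B : Matrix (Fin (n + 1)) (Fin (n + 1)) ℂ) :
    frameVec v B 0 = v := by
  have h := (charpoly_monic B).coeff_natDegree
  rw [natDegree_charpoly_fin] at h
  simp [frameVec, h]

/-- Horner's scheme for the characteristic polynomial applied to `v`. -/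
theorem frameVec_succ (v : Fin (n + 1) → ℂ) (B : Matrix (Fin (n + 1)) (Fin (n + 1)) ℂ) {k : ℕ}
    (hk : k ≤ n) :
    frameVec v B (k + 1) = B *ᵥ frameVec v B k + B.charpoly.coeff (n - k) • v := by
  rw [frameVec, Finset.sum_range_succ', frameVec, mulVec_sum]
  congr 1
  · refine Finset.sum_congr rfl fun j _ => ?_
    rw [mulVec_smul, mulVec_mulVec, ← pow_succ']
    congr 2
    omega
  · simp [show n + 1 - (k + 1) = n - k by omega]

/-- This is Cayley–Hamilton applied to `v`. -/
theorem frameVec_last (v : Fin (n + 1) → ℂ) (B : Matrix (Fin (n + 1)) (Fin (n + 1)) ℂ) :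
    frameVec v B (n + 1) = 0 := by
  have h := aeval_self_charpoly B
  rw [Polynomial.aeval_eq_sum_range, natDegree_charpoly_fin] at h
  have h' := congrArg (fun X => X *ᵥ v) h
  simp only [sum_mulVec, smul_mulVec, zero_mulVec] at h'
  simpa [frameVec] using h'

/-- The matrix with columns `frameVec v B k`, `k ≤ n`. -/
def frame (v : Fin (n + 1) → ℂ) (B : Matrix (Fin (n + 1)) (Fin (n + 1)) ℂ) :
    Matrix (Fin (n + 1)) (Fin (n + 1)) ℂ := of fun r k => frameVec v B k r

/-- The nilpotent Jordan block `e₀ ↦ e₁ ↦ ⋯ ↦ eₙ ↦ 0`. -/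
def shift (n : ℕ) : Matrix (Fin (n + 1)) (Fin (n + 1)) ℂ :=
  of fun r k => if (r : ℕ) = k + 1 then 1 else 0

/-- Horner's recursion read column by column; the vanishing of the vector of index `n + 1` gives the
last column, where the shift is zero. Up to the rank-one term along `v`, the frame conjugates `B` to
the shift. -/
theorem mul_frame (v : Fin (n + 1) → ℂ) (B : Matrix (Fin (n + 1)) (Fin (n + 1)) ℂ) :
    B * frame v B = frame v B * shift n -
      vecMulVec v fun k : Fin (n + 1) => B.charpoly.coeff (n - k) := by
  ext r k
  have h1 : (B * frame v B) r k = (B *ᵥ frameVec v B k) r := rfl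
  have h2 : (frame v B * shift n) r k = frameVec v B (k + 1) r := by
    by_cases hk : (k : ℕ) < n
    · have hkn : (k : ℕ) + 1 < n + 1 := by omega
      rw [mul_apply, Finset.sum_eq_single (⟨k + 1, hkn⟩ : Fin (n + 1))]
      · simp [shift, frame]
      · intro j _ hj
        have : (j : ℕ) ≠ k + 1 := fun h => hj (Fin.ext h)
        simp [shift, this]
      · simp
    · have hkn : (k : ℕ) = n := by omega
      rw [hkn, frameVec_last, mul_apply]
      refine Finset.sum_eq_zero fun j _ => ?_
      have : (j : ℕ) ≠ k + 1 := by omega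
      simp [shift, this]
  rw [h1, Matrix.sub_apply, h2, frameVec_succ v B (by omega)]
  simp [vecMulVec_apply, mul_comm]

theorem frame_mulVec_single (v : Fin (n + 1) → ℂ) (B : Matrix (Fin (n + 1)) (Fin (n + 1)) ℂ) :
    frame v B *ᵥ Pi.single 0 1 = v := by
  rw [mulVec_single_one]
  funext r
  change frameVec v B 0 r = v r
  rw [frameVec_zero]

/-- The standard point of `(ℙⁿ)⁽²⁾`. -/
def standardJet (n : ℕ) : ProjProlongation n := linearJet (Pi.single 0 1) (shift n)

theorem coeff_charpoly_traceFree (B : Matrix (Fin (n + 1)) (Fin (n + 1)) ℂ) :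
    (traceFree B).charpoly.coeff n = 0 := by
  have h := trace_eq_neg_charpoly_coeff (traceFree B)
  rw [trace_traceFree] at h
  simpa using h.symm

/-- Conjugating the shift by the frame gives the trace-free part of `B` plus some `v ⊗ l` with `l(v)
= 0`, which the jet at `[v]` does not see. The scalar `a` only serves to reach determinant one. -/
theorem mk_smul_standardJet {v : Fin (n + 1) → ℂ} (hv : v ≠ 0)
    (B : Matrix (Fin (n + 1)) (Fin (n + 1)) ℂ) {a : ℂ}
    (A : Matrix.SpecialLinearGroup (Fin (n + 1)) ℂ) (hA : A.1 = a • frame v (traceFree B)) :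
    (QuotientGroup.mk A : PSL n) • standardJet n = linearJet v B := by
  have ha : a ≠ 0 := by
    rintro rfl
    have h := A.2
    rw [hA] at h
    simp at h
  have h1 : A.1 *ᵥ Pi.single 0 1 = a • v := by rw [hA, smul_mulVec, frame_mulVec_single]
  have h2 : A.1 * (A⁻¹).1 = 1 := congrArg Subtype.val (mul_inv_cancel A)
  have h2' : (A⁻¹).1 * A.1 = 1 := congrArg Subtype.val (inv_mul_cancel A)
  set c : Fin (n + 1) → ℂ := fun k : Fin (n + 1) => (traceFree B).charpoly.coeff (n - k) with hc
  have h3 : traceFree B * A.1 = A.1 * shift n - vecMulVec v (a • c) := by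
    rw [hA, Matrix.mul_smul, mul_frame, vecMulVec_smul, Matrix.smul_mul, smul_sub]
  have h4 : A.1 * shift n * (A⁻¹).1 = traceFree B + (0 : ℂ) • (1 : Matrix _ _ ℂ) +
      vecMulVec v ((a • c) ᵥ* (A⁻¹).1) := by
    have := congrArg (fun X => X * (A⁻¹).1) h3
    simp only [mul_assoc, h2, mul_one, sub_mul, vecMulVec_mul] at this
    rw [this, mul_assoc, zero_smul, add_zero, sub_add_cancel]
  -- As `A⁻¹ v = a⁻¹ e₀`, this number is the coefficient of `X^n` in the characteristic polynomial,
  -- which is minus the trace. Here the trace-free normalization is essential.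
  have h5 : ((a • c) ᵥ* (A⁻¹).1) ⬝ᵥ v = 0 := by
    have h6 : (A⁻¹).1 *ᵥ v = a⁻¹ • Pi.single 0 1 := by
      have h7 : v = a⁻¹ • (A.1 *ᵥ Pi.single 0 1) := by
        rw [h1, smul_smul, inv_mul_cancel₀ ha, one_smul]
      conv_lhs => rw [h7, mulVec_smul, mulVec_mulVec, h2', one_mulVec]
    rw [← dotProduct_mulVec, h6]
    simp [hc, coeff_charpoly_traceFree]
  rw [standardJet, mk_smul_linearJet A (by simp), h1, linearJet_smul ha, h4,
    linearJet_add v hv _ _ _ h5, linearJet_traceFree hv]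

theorem exists_specialLinear_smul (M : Matrix (Fin (n + 1)) (Fin (n + 1)) ℂ) (hM : M.det ≠ 0) :
    ∃ (a : ℂ) (A : Matrix.SpecialLinearGroup (Fin (n + 1)) ℂ), a ≠ 0 ∧ A.1 = a • M := by
  obtain ⟨a, ha⟩ := IsAlgClosed.exists_pow_nat_eq (M.det)⁻¹ n.succ_pos
  have ha' : a ≠ 0 := by
    rintro rfl
    rw [zero_pow n.succ_ne_zero] at ha
    exact inv_ne_zero hM ha.symm
  refine ⟨a, ⟨a • M, ?_⟩, ha', rfl⟩
  rw [det_smul, Fintype.card_fin, ha, inv_mul_cancel₀ hM]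

theorem mk_eq_one_iff (A : Matrix.SpecialLinearGroup (Fin (n + 1)) ℂ) :
    (QuotientGroup.mk A : PSL n) = 1 ↔ ∃ r : ℂ, A.1 = r • (1 : Matrix _ _ ℂ) := by
  rw [QuotientGroup.eq_one_iff, Matrix.SpecialLinearGroup.mem_center_iff]
  constructor
  · rintro ⟨r, -, hr⟩
    exact ⟨r, by rw [← hr, smul_one_eq_diagonal]; rfl⟩
  · rintro ⟨r, hr⟩
    refine ⟨r, ?_, ?_⟩
    · have h := A.2
      rw [hr, det_smul, det_one, mul_one] at h
      exact h
    · rw [hr, smul_one_eq_diagonal]; rfl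

/-- A matrix commuting with the shift up to its first row, and with first column a multiple of the
first basis vector, is scalar. -/
theorem eq_smul_one_of_shift {A : Matrix (Fin (n + 1)) (Fin (n + 1)) ℂ} {l : Fin (n + 1) → ℂ}
    (h0 : ∀ j : Fin (n + 1), j ≠ 0 → A j 0 = 0)
    (h : A * shift n = shift n * A + vecMulVec (Pi.single 0 1) l) :
    A = A 0 0 • (1 : Matrix _ _ ℂ) := by
  have hR : ∀ (r k : Fin (n + 1)) (hk : (k : ℕ) + 1 < n + 1),
      (A * shift n) r k = A r ⟨k + 1, hk⟩ := by
    intro r k hk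
    rw [mul_apply, Finset.sum_eq_single (⟨k + 1, hk⟩ : Fin (n + 1))]
    · simp [shift]
    · intro j _ hj
      have : (j : ℕ) ≠ k + 1 := fun h => hj (Fin.ext h)
      simp [shift, this]
    · simp
  have hRn : ∀ r : Fin (n + 1), (A * shift n) r (Fin.last n) = 0 := by
    intro r
    rw [mul_apply]
    refine Finset.sum_eq_zero fun j _ => ?_
    have : (j : ℕ) ≠ n + 1 := by omega
    simp [shift, this]
  have hL : ∀ (r : Fin (n + 1)) (hr : (r : ℕ) + 1 < n + 1) (k : Fin (n + 1)),
      (shift n * A + vecMulVec (Pi.single 0 1) l : Matrix _ _ ℂ) ⟨r + 1, hr⟩ k = A r k := by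
    intro r hr k
    have h1 : (⟨r + 1, hr⟩ : Fin (n + 1)) ≠ 0 := by
      intro h; simpa using congrArg Fin.val h
    rw [Matrix.add_apply, mul_apply, Finset.sum_eq_single r]
    · simp [shift, vecMulVec_apply, h1]
    · intro j _ hj
      have : (r : ℕ) ≠ j := fun h => hj (Fin.ext h.symm)
      simp [shift, this]
    · simp
  -- Off the first row the relation is a genuine commutation with the shift, so `A` is constant
  -- along diagonals.
  have hstep : ∀ (r k : ℕ) (hr : r + 1 < n + 1) (hk : k + 1 < n + 1),
      A ⟨r + 1, hr⟩ ⟨k + 1, hk⟩ = A ⟨r, by omega⟩ ⟨k, by omega⟩ := by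
    intro r k hr hk
    have e := congrFun (congrFun h ⟨r + 1, hr⟩) ⟨k, by omega⟩
    rw [hR _ ⟨k, by omega⟩ hk, hL ⟨r, by omega⟩ hr] at e
    exact e
  -- The shift has zero last column. Diagonals above the main one end in these entries, while those
  -- below it start in the first column.
  have hlast : ∀ (r : ℕ) (hr : r + 1 < n + 1), A ⟨r, by omega⟩ (Fin.last n) = 0 := by
    intro r hr
    have e := congrFun (congrFun h ⟨r + 1, hr⟩) (Fin.last n)
    rw [hRn, hL ⟨r, by omega⟩ hr] at e
    exact e.symm
  have hupper : ∀ (d r k : ℕ) (hr : r < n + 1) (hk : k < n + 1), r < k → k + d = n →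
      A ⟨r, hr⟩ ⟨k, hk⟩ = 0 := by
    intro d
    induction d with
    | zero =>
      intro r k hr hk hrk hkd
      obtain rfl : k = n := by omega
      exact hlast r (by omega)
    | succ d ih =>
      intro r k hr hk hrk hkd
      rw [← hstep r k (by omega) (by omega)]
      exact ih _ _ _ _ (by omega) (by omega)
  have hlower : ∀ (k r : ℕ) (hr : r < n + 1) (hk : k < n + 1), k ≤ r →
      A ⟨r, hr⟩ ⟨k, hk⟩ = A ⟨r - k, by omega⟩ 0 := by
    intro k
    induction k with
    | zero => intro r hr hk hrk; rfl
    | succ k ih =>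
      intro r hr hk hrk
      obtain ⟨r, rfl⟩ : ∃ s, r = s + 1 := ⟨r - 1, by omega⟩
      rw [hstep r k hr hk, ih r (by omega) (by omega) (by omega)]
      congr 2
      omega
  ext r k
  rcases lt_trichotomy (r : ℕ) k with hrk | hrk | hrk
  · rw [hupper (n - k) r k r.2 k.2 hrk (by omega)]
    have : r ≠ k := fun h => by simp [h] at hrk
    simp [this]
  · have hrk' := Fin.ext hrk
    subst hrk'
    have := hlower r r r.2 r.2 le_rfl
    simp only [Nat.sub_self] at this
    simpa using this
  · have hne : r ≠ k := fun h => by simp [h] at hrk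
    have h1 := hlower k r r.2 k.2 hrk.le
    rw [h0] at h1
    · simpa [hne] using h1
    · intro h; have := congrArg Fin.val h; simp at this; omega

/-- An element of the stabilizer fixes the line of `e₀` and conjugates the shift to itself up to a
scalar and some `e₀ ⊗ l`. The trace excludes the scalar, and commutation with the shift outside the
first row then forces a scalar matrix. -/
theorem stabilizer_standardJet (n : ℕ) :
    MulAction.stabilizer (PSL n) (standardJet n) = ⊥ := by
  rw [eq_bot_iff]
  intro g hg
  rw [MulAction.mem_stabilizer_iff] at hg
  rw [Subgroup.mem_bot]
  induction g using QuotientGroup.induction_on with | _ A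
  have he : (Pi.single 0 1 : Fin (n + 1) → ℂ) ≠ 0 := by simp
  rw [standardJet, mk_smul_linearJet A he] at hg
  have hb : toProj (A.1 *ᵥ Pi.single 0 1) = toProj (Pi.single 0 1) :=
    congrArg SecondProlongation.base hg
  rw [toProj_of_ne he, toProj_of_ne (mulVec_ne_zero A he), Projectivization.mk_eq_mk_iff'] at hb
  obtain ⟨b, hb⟩ := hb
  have hb0 : b ≠ 0 := by
    rintro rfl
    exact mulVec_ne_zero A he (by rw [← hb, zero_smul])
  rw [← hb, linearJet_smul hb0] at hg
  obtain ⟨a, l, hl, h⟩ := exists_of_linearJet_eq hg.symm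
  have h2' : (A⁻¹).1 * A.1 = 1 := congrArg Subtype.val (inv_mul_cancel A)
  -- Conjugation preserves the trace and `e₀ ⊗ l` has trace `l 0 = 0`, so `(n + 1) a = 0`.
  have ha : a = 0 := by
    have ht := congrArg trace h
    rw [trace_mul_comm, ← mul_assoc, h2', one_mul] at ht
    have hn : (n + 1 : ℂ) ≠ 0 := by exact_mod_cast n.succ_ne_zero
    simpa [trace_add, trace_vecMulVec, hl, hn] using ht
  have h3 : A.1 * shift n = shift n * A.1 + vecMulVec (Pi.single 0 1) (l ᵥ* A.1) := by
    have := congrArg (fun X => X * A.1) h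
    simpa only [mul_assoc, h2', mul_one, ha, zero_smul, add_zero, add_mul, vecMulVec_mul]
      using this
  refine (mk_eq_one_iff A).2 ⟨_, eq_smul_one_of_shift (fun j hj => ?_) h3⟩
  have := congrFun hb j
  rw [mulVec_single_one] at this
  simpa [hj] using this.symm

/-- When the frame is degenerate, the covectors that annihilate it form a non-zero space stable
under `B`, which contains an eigenvector `m`. If `u` is an eigenvector of `B` for the same
eigenvalue, `1 + u ⊗ m` commutes with `B` and fixes `v`. -/
theorem exists_smul_linearJet_eq_of_det_eq_zero {v : Fin (n + 1) → ℂ} (hv : v ≠ 0)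
    (B : Matrix (Fin (n + 1)) (Fin (n + 1)) ℂ) (h : (frame v B).det = 0) :
    ∃ g : PSL n, g ≠ 1 ∧ g • linearJet v B = linearJet v B := by
  obtain ⟨m₀, hm₀, hm₀'⟩ := exists_vecMul_eq_zero_iff.2 h
  let W : Submodule ℂ (Fin (n + 1) → ℂ) := LinearMap.ker (vecMulLinear (frame v B))
  have hW : ∀ m, m ∈ W ↔ ∀ k : Fin (n + 1), m ⬝ᵥ frameVec v B k = 0 := fun m => by
    rw [LinearMap.mem_ker, vecMulLinear_apply, funext_iff]
    rfl
  have hinv : ∀ m ∈ W, vecMulLinear B m ∈ W := by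
    intro m hm
    rw [hW] at hm ⊢
    intro k
    have hv0 : m ⬝ᵥ v = 0 := by simpa [frameVec_zero] using hm 0
    -- For the last index `k = n` the next frame vector is zero, so the recursion still applies.
    have h1 : m ⬝ᵥ frameVec v B (k + 1) = 0 := by
      by_cases hk : (k : ℕ) < n
      · simpa using hm ⟨k + 1, by omega⟩
      · have hkn : (k : ℕ) = n := by omega
        rw [hkn, frameVec_last, dotProduct_zero]
    rw [frameVec_succ v B (by omega), dotProduct_add, dotProduct_smul, hv0, smul_zero,
      add_zero, dotProduct_mulVec] at h1
    exact h1
  have hnt : Nontrivial W := ⟨⟨⟨m₀, hm₀'⟩, 0, fun h => hm₀ (congrArg Subtype.val h)⟩⟩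
  obtain ⟨α, hα⟩ := Module.End.exists_eigenvalue ((vecMulLinear B).restrict hinv)
  obtain ⟨⟨m, hmW⟩, hmv⟩ := hα.exists_hasEigenvector
  have hm0 : m ≠ 0 := fun h => hmv.2 (Subtype.ext h)
  have hmB : m ᵥ* B = α • m := congrArg Subtype.val hmv.apply_eq_smul
  have hmv0 : m ⬝ᵥ v = 0 := by simpa [frameVec_zero] using (hW m).1 hmW 0
  have hdet : (B - α • (1 : Matrix _ _ ℂ)).det = 0 :=
    exists_vecMul_eq_zero_iff.1 ⟨m, hm0, by rw [vecMul_sub, hmB, vecMul_smul, vecMul_one, sub_self]⟩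
  obtain ⟨u₀, hu₀, hu₀B⟩ := exists_mulVec_eq_zero_iff.2 hdet
  rw [sub_mulVec, smul_mulVec, one_mulVec, sub_eq_zero] at hu₀B
  -- Invertibility of `1 + u ⊗ m` requires `1 + m(u) ≠ 0`. If this fails for the given eigenvector,
  -- doubling it gives `1 + m(u) = -1`.
  obtain ⟨u, hu, huB, hmu⟩ : ∃ u, u ≠ 0 ∧ B *ᵥ u = α • u ∧ 1 + m ⬝ᵥ u ≠ 0 := by
    by_cases h1 : 1 + m ⬝ᵥ u₀ = 0
    · refine ⟨(2 : ℂ) • u₀, smul_ne_zero two_ne_zero hu₀, ?_, ?_⟩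
      · rw [mulVec_smul, hu₀B, smul_comm]
      · rw [dotProduct_smul, eq_neg_of_add_eq_zero_right h1]
        norm_num
    · exact ⟨u₀, hu₀, hu₀B, h1⟩
  set T : Matrix (Fin (n + 1)) (Fin (n + 1)) ℂ := 1 + vecMulVec u m with hT
  have hTdet : T.det ≠ 0 := by
    rw [hT, vecMulVec_eq Unit, det_one_add_replicateCol_mul_replicateRow]
    exact hmu
  have hTv : T *ᵥ v = v := by
    rw [hT, add_mulVec, one_mulVec, vecMulVec_mulVec, hmv0]
    simp
  have hTB : T * B = B * T := by
    rw [hT, add_mul, mul_add, one_mul, mul_one, vecMulVec_mul, mul_vecMulVec, hmB, huB,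
      vecMulVec_smul, smul_vecMulVec]
  obtain ⟨a, A, ha, hA⟩ := exists_specialLinear_smul T hTdet
  refine ⟨QuotientGroup.mk A, fun h1 => ?_, ?_⟩
  · obtain ⟨r, hr⟩ := (mk_eq_one_iff A).1 h1
    rw [hA] at hr
    have h2 := congrArg (fun X => X *ᵥ v) hr
    simp only [smul_mulVec, hTv, one_mulVec] at h2
    -- A scalar multiple of `T` that is itself scalar must be `a • 1`, because `T` fixes `v`; this
    -- would make `u ⊗ m` zero.
    have har : a = r := smul_left_injective ℂ hv h2
    rw [← har] at hr
    have h3 : vecMulVec u m = 0 := by simpa [hT] using smul_right_injective _ ha hr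
    exact (vecMulVec_ne_zero hu hm0) h3
  · have h2 : A.1 * (A⁻¹).1 = 1 := congrArg Subtype.val (mul_inv_cancel A)
    have h3 : A.1 * B = B * A.1 := by rw [hA, Matrix.smul_mul, Matrix.mul_smul, hTB]
    rw [mk_smul_linearJet A hv, h3, mul_assoc, h2, mul_one, hA, smul_mulVec, hTv, linearJet_smul ha]

theorem linearJet_mem_trivialIsotropy_iff {v : Fin (n + 1) → ℂ} (hv : v ≠ 0)
    (B : Matrix (Fin (n + 1)) (Fin (n + 1)) ℂ) :
    linearJet v B ∈ trivialIsotropy n ↔ (frame v (traceFree B)).det ≠ 0 := by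
  constructor
  · intro h h0
    obtain ⟨g, hg, hg'⟩ := exists_smul_linearJet_eq_of_det_eq_zero hv _ h0
    rw [linearJet_traceFree hv] at hg'
    have : g ∈ MulAction.stabilizer (PSL n) (linearJet v B) := hg'
    rw [show MulAction.stabilizer (PSL n) (linearJet v B) = ⊥ from h] at this
    exact hg this
  · intro h
    obtain ⟨a, A, -, hA⟩ := exists_specialLinear_smul _ h
    rw [← mk_smul_standardJet hv B A hA]
    change MulAction.stabilizer (PSL n) _ = ⊥
    rw [MulAction.stabilizer_smul_eq_stabilizer_map_conj, stabilizer_standardJet, Subgroup.map_bot]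

theorem orbit_eq_trivialIsotropy {q : ProjProlongation n} (hq : q ∈ trivialIsotropy n) :
    MulAction.orbit (PSL n) q = trivialIsotropy n := by
  have key : MulAction.orbit (PSL n) (standardJet n) = trivialIsotropy n := by
    ext p
    constructor
    · rintro ⟨g, rfl⟩
      change MulAction.stabilizer (PSL n) (g • standardJet n) = ⊥
      rw [MulAction.stabilizer_smul_eq_stabilizer_map_conj, stabilizer_standardJet,
        Subgroup.map_bot]
    · intro hp
      obtain ⟨v, B, hv, rfl⟩ := exists_eq_linearJet p
      obtain ⟨a, A, -, hA⟩ :=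
        exists_specialLinear_smul _ ((linearJet_mem_trivialIsotropy_iff hv B).1 hp)
      exact ⟨_, mk_smul_standardJet hv B A hA⟩
  rw [← key] at hq ⊢
  exact MulAction.orbit_eq_iff.2 hq

end Frames

/-! ### Functions with denominator a power of a given polynomial. -/

section RationalFunctions

open MvPolynomial

variable {σ τ : Type*}

/-- The functions on the affine space `ℂ^σ` that coincide, where `D ≠ 0`, with a quotient of a
polynomial by a power of `D`. -/
def ratFun (D : MvPolynomial σ ℂ) : Subalgebra ℂ ((σ → ℂ) → ℂ) where
  carrier := {F | ∃ (N : ℕ) (P : MvPolynomial σ ℂ), ∀ x, eval x D ≠ 0 →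
    F x = eval x P / eval x D ^ N}
  mul_mem' := by
    rintro F G ⟨N, P, hF⟩ ⟨K, Q, hG⟩
    refine ⟨N + K, P * Q, fun x hx => ?_⟩
    rw [Pi.mul_apply, hF x hx, hG x hx, map_mul, pow_add, div_mul_div_comm]
  add_mem' := by
    rintro F G ⟨N, P, hF⟩ ⟨K, Q, hG⟩
    refine ⟨N + K, P * D ^ K + D ^ N * Q, fun x hx => ?_⟩
    rw [Pi.add_apply, hF x hx, hG x hx, div_add_div _ _ (pow_ne_zero _ hx) (pow_ne_zero _ hx),
      pow_add]
    simp
  algebraMap_mem' a := ⟨0, C a, fun x _ => by simp⟩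

theorem eval_mem_ratFun (D P : MvPolynomial σ ℂ) : (fun x => eval x P) ∈ ratFun D :=
  ⟨0, P, fun x _ => by simp⟩

theorem coord_mem_ratFun (D : MvPolynomial σ ℂ) (i : σ) : (fun x => x i) ∈ ratFun D := by
  simpa using eval_mem_ratFun D (X i)

theorem inv_mem_ratFun (D : MvPolynomial σ ℂ) : (fun x => (eval x D)⁻¹) ∈ ratFun D :=
  ⟨1, 1, fun x _ => by simp⟩

theorem mem_ratFun_one_iff {F : (σ → ℂ) → ℂ} :
    F ∈ ratFun (1 : MvPolynomial σ ℂ) ↔ ∃ P : MvPolynomial σ ℂ, ∀ x, F x = eval x P :=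
  ⟨fun ⟨_, P, h⟩ => ⟨P, fun x => by simpa using h x (by simp)⟩,
    fun ⟨P, h⟩ => ⟨0, P, fun x _ => by simpa using h x⟩⟩

theorem ratFun_one_le (D : MvPolynomial σ ℂ) : ratFun (1 : MvPolynomial σ ℂ) ≤ ratFun D := by
  intro F hF
  obtain ⟨P, h⟩ := mem_ratFun_one_iff.1 hF
  rw [show F = fun x => eval x P from funext h]
  exact eval_mem_ratFun D P

end RationalFunctions

/-! ### Closure of function algebras under matrix operations. -/

section FunctionAlgebras

open Matrix

variable {X m : Type*} {S : Subalgebra ℂ (X → ℂ)}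

theorem const_mem (a : ℂ) : (fun _ => a) ∈ S := S.algebraMap_mem a

theorem fun_add_mem {F G : X → ℂ} (hF : F ∈ S) (hG : G ∈ S) : (fun x => F x + G x) ∈ S :=
  S.add_mem hF hG

theorem fun_sub_mem {F G : X → ℂ} (hF : F ∈ S) (hG : G ∈ S) : (fun x => F x - G x) ∈ S :=
  S.sub_mem hF hG

theorem fun_mul_mem {F G : X → ℂ} (hF : F ∈ S) (hG : G ∈ S) : (fun x => F x * G x) ∈ S :=
  S.mul_mem hF hG

theorem fun_sum_mem {ι : Type*} {s : Finset ι} {F : ι → X → ℂ} (hF : ∀ i ∈ s, F i ∈ S) :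
    (fun x => ∑ i ∈ s, F i x) ∈ S := by
  have := S.sum_mem hF
  rwa [Finset.sum_fn] at this

theorem fun_eval_mem {τ : Type*} {F : τ → X → ℂ} (hF : ∀ j, F j ∈ S) (P : MvPolynomial τ ℂ) :
    (fun x => MvPolynomial.eval (fun j => F j x) P) ∈ S := by
  induction P using MvPolynomial.induction_on with
  | C a => simpa using const_mem a
  | add P Q hP hQ => simpa using fun_add_mem hP hQ
  | mul_X P j hP => simpa using fun_mul_mem hP (hF j)

variable [Fintype m]

theorem fun_mulVec_mem {M : X → Matrix m m ℂ} {v : X → m → ℂ} (hM : ∀ i j, (fun x => M x i j) ∈ S)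
    (hv : ∀ i, (fun x => v x i) ∈ S) (i : m) : (fun x => (M x *ᵥ v x) i) ∈ S :=
  fun_sum_mem fun j _ => fun_mul_mem (hM i j) (hv j)

theorem fun_matrix_mul_mem {M N : X → Matrix m m ℂ} (hM : ∀ i j, (fun x => M x i j) ∈ S)
    (hN : ∀ i j, (fun x => N x i j) ∈ S) (i j : m) : (fun x => (M x * N x) i j) ∈ S := by
  simp only [mul_apply]
  exact fun_sum_mem fun k _ => fun_mul_mem (hM i k) (hN k j)

variable [DecidableEq m]

theorem fun_matrix_pow_mem {M : X → Matrix m m ℂ} (hM : ∀ i j, (fun x => M x i j) ∈ S) (k : ℕ) :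
    ∀ i j, (fun x => (M x ^ k) i j) ∈ S := by
  induction k with
  | zero => intro i j; simpa using const_mem ((1 : Matrix m m ℂ) i j)
  | succ k ih => intro i j; simpa only [pow_succ] using fun_matrix_mul_mem ih hM i j

/-- The matrix over the ring `S` of functions defined by a matrix-valued function. -/
def funMatrix {M : X → Matrix m m ℂ} (hM : ∀ i j, (fun x => M x i j) ∈ S) : Matrix m m S :=
  of fun i j => ⟨fun x => M x i j, hM i j⟩

/-- Evaluation at `x` on a ring `S` of functions. -/
def evalAt (S : Subalgebra ℂ (X → ℂ)) (x : X) : S →+* ℂ :=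
  (Pi.evalRingHom (fun _ => ℂ) x).comp S.val.toRingHom

theorem map_funMatrix {M : X → Matrix m m ℂ} (hM : ∀ i j, (fun x => M x i j) ∈ S) (x : X) :
    (evalAt S x).mapMatrix (funMatrix hM) = M x := rfl

/-- The determinant can be computed over the ring `S` itself, and evaluation at a point is a ring
homomorphism. The adjugate and the characteristic polynomial are treated in the same way. -/
theorem fun_det_mem {M : X → Matrix m m ℂ} (hM : ∀ i j, (fun x => M x i j) ∈ S) :
    (fun x => (M x).det) ∈ S := by
  have : (fun x => (M x).det) = (funMatrix hM).det.1 := by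
    funext x
    rw [← map_funMatrix hM x, ← RingHom.map_det]
    rfl
  rw [this]
  exact Subtype.property _

theorem fun_adjugate_mem {M : X → Matrix m m ℂ} (hM : ∀ i j, (fun x => M x i j) ∈ S) (i j : m) :
    (fun x => (M x).adjugate i j) ∈ S := by
  have : (fun x => (M x).adjugate i j) = ((funMatrix hM).adjugate i j).1 := by
    funext x
    rw [← map_funMatrix hM x, ← RingHom.map_adjugate]
    rfl
  rw [this]
  exact Subtype.property _

theorem fun_coeff_charpoly_mem {M : X → Matrix m m ℂ} (hM : ∀ i j, (fun x => M x i j) ∈ S)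
    (k : ℕ) : (fun x => (M x).charpoly.coeff k) ∈ S := by
  have : (fun x => (M x).charpoly.coeff k) = ((funMatrix hM).charpoly.coeff k).1 := by
    funext x
    rw [← map_funMatrix hM x, RingHom.mapMatrix_apply, charpoly_map, Polynomial.coeff_map]
    rfl
  rw [this]
  exact Subtype.property _

end FunctionAlgebras

/-! ### Criteria for morphisms, in particular to the quotient `PSL(n+1, ℂ)`. -/

section Morphisms

open MvPolynomial

variable {X Y : Type*}

/-- A map given in coordinates by rational functions, on basic open sets that cover the source, is
a morphism. -/
theorem isMorphismAt_of_ratFun (A : VarietyData X) (B : VarietyData Y) (f : X → Y)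
    (D : ∀ a, B.index → MvPolynomial (A.vars a) ℂ)
    (F : ∀ a b, B.vars b → (A.vars a → ℂ) → ℂ)
    (hF : ∀ a b j, F a b j ∈ ratFun (D a b))
    (hf : ∀ a b (c : A.piece a), eval (A.coord a c) (D a b) ≠ 0 →
      ∃ c' : B.piece b, B.toSpace b c' = f (A.toSpace a c) ∧
        B.coord b c' = fun j => F a b j (A.coord a c))
    (hcov : ∀ a (c : A.piece a), ∃ b, eval (A.coord a c) (D a b) ≠ 0) (x : X) :
    IsMorphismAt A B f x := by
  constructor
  · have : @Continuous X Y A.zariski B.zariski f := by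
      refine @Continuous.mk X Y A.zariski B.zariski f fun V hV a => ?_
      choose S hS using hV
      -- The equations of `V` are pulled back and their numerators kept; the factor `D` confines
      -- each one to the set where its rational expression is valid.
      refine ⟨{R | ∃ b, ∃ P ∈ S b, ∃ (N : ℕ) (Q : MvPolynomial (A.vars a) ℂ),
        (∀ x, eval x (D a b) ≠ 0 → eval (fun j => F a b j x) P = eval x Q / eval x (D a b) ^ N) ∧
        R = D a b * Q}, fun c => ?_⟩
      constructor
      · intro hc
        obtain ⟨b, hb⟩ := hcov a c
        obtain ⟨c', hc', hc''⟩ := hf a b c hb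
        have hc1 : B.toSpace b c' ∈ V := hc' ▸ hc
        obtain ⟨P, hP, hP'⟩ := (hS b c').1 hc1
        obtain ⟨N, Q, hQ⟩ := fun_eval_mem (hF a b) P
        refine ⟨_, ⟨b, P, hP, N, Q, hQ, rfl⟩, ?_⟩
        rw [map_mul]
        refine mul_ne_zero hb fun h0 => hP' ?_
        rw [hc'']
        exact (hQ _ hb).trans (by rw [h0, zero_div])
      · rintro ⟨_, ⟨b, P, hP, N, Q, hQ, rfl⟩, h⟩
        rw [map_mul] at h
        have hb := left_ne_zero_of_mul h
        obtain ⟨c', hc', hc''⟩ := hf a b c hb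
        have hc1 : B.toSpace b c' ∈ V := by
          refine (hS b c').2 ⟨P, hP, ?_⟩
          rw [hc'', hQ _ hb]
          exact div_ne_zero (right_ne_zero_of_mul h) (pow_ne_zero _ hb)
        change f (A.toSpace a c) ∈ V
        rwa [← hc']
    exact @Continuous.continuousAt X Y A.zariski B.zariski f x this
  · intro h hh a c hc
    obtain ⟨b, hb⟩ := hcov a c
    obtain ⟨c', hc', hc''⟩ := hf a b c hb
    obtain ⟨P, Q, hQ, hPQ⟩ := hh b c' (by rw [hc', hc])
    obtain ⟨N, P', hP'⟩ := fun_eval_mem (hF a b) P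
    obtain ⟨K, Q', hQ'⟩ := fun_eval_mem (hF a b) Q
    dsimp only at hP' hQ'
    -- The pullback of `P / Q` is `(P' / D^N) / (Q' / D^K)`. One more factor `D` above and below
    -- makes a non-zero denominator imply `D ≠ 0`, even for `N = 0`.
    refine ⟨P' * D a b ^ (K + 1), Q' * D a b ^ (N + 1), ?_, fun e he => ?_⟩
    · rw [map_mul, map_pow]
      refine mul_ne_zero (fun h0 => hQ ?_) (pow_ne_zero _ hb)
      rw [hc'']
      exact (hQ' _ hb).trans (by rw [h0, zero_div])
    · rw [map_mul, map_pow] at he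
      have he1 := left_ne_zero_of_mul he
      have he2 : eval (A.coord a e) (D a b) ≠ 0 := fun h0 =>
        right_ne_zero_of_mul he (by rw [h0, zero_pow N.succ_ne_zero])
      obtain ⟨e', he', he''⟩ := hf a b e he2
      have h1 : eval (B.coord b e') Q ≠ 0 := by
        rw [he'', hQ' _ he2]
        exact div_ne_zero he1 (pow_ne_zero _ he2)
      rw [Function.comp_apply, ← he', hPQ e' h1, he'', hP' _ he2, hQ' _ he2]
      simp only [map_mul, map_pow]
      field_simp
      ring

/-- A polynomial in the entries of `a • M`, where `a ^ (n + 1) * D = 1`, is a polynomial of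
degree at most `n` in `a`, with coefficients that are rational functions. -/
theorem exists_eval_smul_eq {σ : Type*} {M : (σ → ℂ) → Matrix (Fin (n + 1)) (Fin (n + 1)) ℂ}
    (hM : ∀ i j, (fun x => M x i j) ∈ ratFun 1) (D : MvPolynomial σ ℂ)
    (P : MvPolynomial (Fin (n + 1) × Fin (n + 1)) ℂ) :
    ∃ p : Fin (n + 1) → (σ → ℂ) → ℂ, (∀ r, p r ∈ ratFun D) ∧
      ∀ x (a : ℂ), a ^ (n + 1) * eval x D = 1 →
        eval (fun ij => (a • M x) ij.1 ij.2) P = ∑ r : Fin (n + 1), a ^ (r : ℕ) * p r x := by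
  induction P using MvPolynomial.induction_on with
  | C c =>
    refine ⟨Fin.cons (fun _ => c) fun _ _ => 0, fun r => ?_, fun x a _ => ?_⟩
    · refine Fin.cases ?_ (fun r => ?_) r
      · exact const_mem c
      · exact const_mem 0
    · simp [Fin.sum_univ_succ]
  | add P Q hP hQ =>
    obtain ⟨p, hp, hp'⟩ := hP
    obtain ⟨q, hq, hq'⟩ := hQ
    refine ⟨fun r x => p r x + q r x, fun r => fun_add_mem (hp r) (hq r), fun x a ha => ?_⟩
    simp only [map_add, hp' x a ha, hq' x a ha, mul_add, Finset.sum_add_distrib]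
  | mul_X P ij hP =>
    obtain ⟨p, hp, hp'⟩ := hP
    have hm := ratFun_one_le D (hM ij.1 ij.2)
    -- Multiplication by an entry of `a • M` raises the degree in `a` by one; the top term `a^(n+1)`
    -- becomes `D⁻¹` and returns to degree zero.
    refine ⟨Fin.cons (fun x => p (Fin.last n) x * M x ij.1 ij.2 * (eval x D)⁻¹)
      fun r x => p r.castSucc x * M x ij.1 ij.2, fun r => ?_, fun x a ha => ?_⟩
    · refine Fin.cases ?_ (fun r => ?_) r
      · exact fun_mul_mem (fun_mul_mem (hp _) hm) (inv_mem_ratFun D)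
      · exact fun_mul_mem (hp _) hm
    · have ha' : (eval x D)⁻¹ = a ^ (n + 1) := (eq_inv_of_mul_eq_one_left ha).symm
      rw [map_mul, hp' x a ha, eval_X, Fin.sum_univ_castSucc, Fin.sum_univ_succ, add_mul,
        Finset.sum_mul]
      simp only [Fin.cons_zero, Fin.cons_succ, Matrix.smul_apply, smul_eq_mul, ha',
        Fin.val_castSucc, Fin.val_succ, Fin.val_last, Fin.val_zero]
      rw [add_comm]
      congr 1
      · ring
      · exact Finset.sum_congr rfl fun r _ => by ring

/-- The equation has `n + 1` distinct roots, one of them times the roots of unity of order `n + 1`.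
A polynomial of degree at most `n` vanishing at all of them is zero, by Vandermonde. -/
theorem eq_zero_of_forall_root {d : ℂ} (hd : d ≠ 0) {c : Fin (n + 1) → ℂ}
    (h : ∀ a : ℂ, a ^ (n + 1) * d = 1 → ∑ r : Fin (n + 1), a ^ (r : ℕ) * c r = 0) : c = 0 := by
  obtain ⟨b, hb⟩ := IsAlgClosed.exists_pow_nat_eq d⁻¹ n.succ_pos
  have hb0 : b ≠ 0 := by
    rintro rfl
    rw [zero_pow n.succ_ne_zero] at hb
    exact inv_ne_zero hd hb.symm
  have hz := Complex.isPrimitiveRoot_exp (n + 1) n.succ_ne_zero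
  set z := Complex.exp (2 * Real.pi * Complex.I / ((n + 1 : ℕ) : ℂ))
  refine Matrix.eq_zero_of_forall_index_sum_mul_pow_eq_zero
    (f := fun k : Fin (n + 1) => b * z ^ (k : ℕ)) (fun k l hkl => ?_) fun k => ?_
  · exact Fin.ext (hz.pow_inj k.2 l.2 (mul_left_cancel₀ hb0 hkl))
  · rw [← h (b * z ^ (k : ℕ))]
    · exact Finset.sum_congr rfl fun r _ => mul_comm _ _
    · rw [mul_pow, hb, ← pow_mul, mul_comm (k : ℕ), pow_mul, hz.pow_eq_one, one_pow, mul_one,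
        inv_mul_cancel₀ hd]

/-- The entries of a matrix in `SL(n+1, ℂ)`. -/
def entries (A : Matrix.SpecialLinearGroup (Fin (n + 1)) ℂ) : Fin (n + 1) × Fin (n + 1) → ℂ :=
  fun ij => A.1 ij.1 ij.2

theorem exists_of_regularAt {h : PSL n → ℂ} {g : PSL n} (hh : (pslVariety n).RegularAt h g)
    (A : Matrix.SpecialLinearGroup (Fin (n + 1)) ℂ) (hA : QuotientGroup.mk A = g) :
    ∃ P Q : MvPolynomial (Fin (n + 1) × Fin (n + 1)) ℂ, eval (entries A) Q ≠ 0 ∧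
      ∀ A' : Matrix.SpecialLinearGroup (Fin (n + 1)) ℂ, eval (entries A') Q ≠ 0 →
        h (QuotientGroup.mk A') = eval (entries A') P / eval (entries A') Q :=
  hh () A hA

theorem exists_of_isZariskiOpen {W : Set (PSL n)} (hW : (pslVariety n).IsZariskiOpen W) :
    ∃ S : Set (MvPolynomial (Fin (n + 1) × Fin (n + 1)) ℂ),
      ∀ A : Matrix.SpecialLinearGroup (Fin (n + 1)) ℂ,
        QuotientGroup.mk A ∈ W ↔ ∃ P ∈ S, eval (entries A) P ≠ 0 :=
  hW ()

/-- A map to `PSL(n+1, ℂ)` given in coordinates by matrices with polynomial entries and non-zero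
determinant is a morphism. -/
theorem isMorphismAt_pslVariety (B : VarietyData Y) (g : Y → PSL n)
    (M : ∀ b, (B.vars b → ℂ) → Matrix (Fin (n + 1)) (Fin (n + 1)) ℂ)
    (hM : ∀ b i j, (fun x => M b x i j) ∈ ratFun 1) {V : Set Y} (hVo : B.IsZariskiOpen V)
    (hV : ∀ b (c : B.piece b), B.toSpace b c ∈ V ↔ (M b (B.coord b c)).det ≠ 0)
    (hg : ∀ b (c : B.piece b) (a : ℂ) (A : Matrix.SpecialLinearGroup (Fin (n + 1)) ℂ),
      A.1 = a • M b (B.coord b c) → QuotientGroup.mk A = g (B.toSpace b c)) {y : Y} (hy : y ∈ V) :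
    IsMorphismAt B (pslVariety n) g y := by
  choose D hD using fun b => mem_ratFun_one_iff.1 (fun_det_mem (hM b))
  have hV' : ∀ b (c : B.piece b), B.toSpace b c ∈ V ↔ eval (B.coord b c) (D b) ≠ 0 := fun b c => by
    rw [hV, hD]
  choose p hp hp' using fun b => exists_eval_smul_eq (hM b) (D b)
  have lift : ∀ b (c : B.piece b) (a : ℂ), a ^ (n + 1) * eval (B.coord b c) (D b) = 1 →
      ∃ A : Matrix.SpecialLinearGroup (Fin (n + 1)) ℂ, A.1 = a • M b (B.coord b c) := by
    intro b c a ha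
    refine ⟨⟨a • M b (B.coord b c), ?_⟩, rfl⟩
    rw [Matrix.det_smul, Fintype.card_fin, hD, ha]
  have hcoord : ∀ b (c : B.piece b) (a : ℂ) (A : Matrix.SpecialLinearGroup (Fin (n + 1)) ℂ)
      (P : MvPolynomial (Fin (n + 1) × Fin (n + 1)) ℂ),
      a ^ (n + 1) * eval (B.coord b c) (D b) = 1 → A.1 = a • M b (B.coord b c) →
      eval (entries A) P = ∑ r : Fin (n + 1), a ^ (r : ℕ) * p b P r (B.coord b c) := by
    intro b c a A P ha hA
    rw [← hp' b P _ a ha, ← hA]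
    rfl
  constructor
  · have hcont : @ContinuousOn Y (PSL n) B.zariski (pslVariety n).zariski g V := by
      refine (@continuousOn_open_iff Y (PSL n) B.zariski (pslVariety n).zariski g V hVo).2
        fun W hW b => ?_
      obtain ⟨S, hS⟩ := exists_of_isZariskiOpen hW
      -- An equation `P` is non-zero at some lift `a • M` exactly when one of its coefficients `p_r`
      -- is non-zero, a condition that no longer involves `a`.
      refine ⟨{R | ∃ P ∈ S, ∃ (r : Fin (n + 1)) (N : ℕ) (Q : MvPolynomial (B.vars b) ℂ),
        (∀ x, eval x (D b) ≠ 0 → p b P r x = eval x Q / eval x (D b) ^ N) ∧ R = D b * Q},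
        fun c => ?_⟩
      constructor
      · rintro ⟨hc, hcW⟩
        have hc0 := (hV b c).1 hc
        have hc1 := (hV' b c).1 hc
        obtain ⟨a, A, -, hA⟩ := exists_specialLinear_smul _ hc0
        have ha : a ^ (n + 1) * eval (B.coord b c) (D b) = 1 := by
          rw [← hD, ← A.2, hA, Matrix.det_smul, Fintype.card_fin]
        have hAW : (QuotientGroup.mk A : PSL n) ∈ W := by
          rw [hg b c a A hA]
          exact hcW
        obtain ⟨P, hP, hP'⟩ := (hS A).1 hAW
        rw [hcoord b c a A P ha hA] at hP'
        obtain ⟨r, -, hr⟩ := Finset.exists_ne_zero_of_sum_ne_zero hP'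
        obtain ⟨N, Q, hQ⟩ := hp b P r
        refine ⟨_, ⟨P, hP, r, N, Q, hQ, rfl⟩, ?_⟩
        rw [map_mul]
        refine mul_ne_zero hc1 fun h0 => right_ne_zero_of_mul hr ?_
        rw [hQ _ hc1, h0, zero_div]
      · rintro ⟨_, ⟨P, hP, r, N, Q, hQ, rfl⟩, h⟩
        rw [map_mul] at h
        have hc1 := left_ne_zero_of_mul h
        refine ⟨(hV' b c).2 hc1, ?_⟩
        have hr : p b P r (B.coord b c) ≠ 0 := by
          rw [hQ _ hc1]
          exact div_ne_zero (right_ne_zero_of_mul h) (pow_ne_zero _ hc1)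
        by_contra hcW
        -- All lifts represent the same element of `PSL`. If it were outside `W`, then `P` would
        -- vanish at every lift, hence so would each of its coefficients.
        refine hr (congrFun (eq_zero_of_forall_root (c := fun r => p b P r (B.coord b c)) hc1
          fun a ha => ?_) r)
        obtain ⟨A, hA⟩ := lift b c a ha
        rw [← hcoord b c a A P ha hA]
        by_contra hPA
        have hAW : (QuotientGroup.mk A : PSL n) ∈ W := (hS A).2 ⟨P, hP, hPA⟩
        rw [hg b c a A hA] at hAW
        exact hcW hAW
    exact @ContinuousOn.continuousAt Y (PSL n) B.zariski (pslVariety n).zariski g V y hcont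
      (@IsOpen.mem_nhds Y B.zariski y V hVo hy)
  · intro h hh b c hc
    have hcV : B.toSpace b c ∈ V := hc ▸ hy
    have hc1 := (hV' b c).1 hcV
    obtain ⟨a, A, -, hA⟩ := exists_specialLinear_smul _ ((hV b c).1 hcV)
    have ha : a ^ (n + 1) * eval (B.coord b c) (D b) = 1 := by
      rw [← hD, ← A.2, hA, Matrix.det_smul, Fintype.card_fin]
    obtain ⟨P, Q, hQ, hPQ⟩ := exists_of_regularAt hh A (by rw [← hc]; exact hg b c a A hA)
    -- The extra factor `Q` on both sides makes the identity hold also where `Q` vanishes, hence at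
    -- every lift.
    have hPQ' : ∀ A' : Matrix.SpecialLinearGroup (Fin (n + 1)) ℂ,
        h (QuotientGroup.mk A') * eval (entries A') (Q * Q) =
          eval (entries A') (P * Q) := by
      intro A'
      by_cases hQA : eval (entries A') Q = 0
      · simp [hQA]
      · rw [hPQ A' hQA, map_mul, map_mul]
        field_simp
    have hQQ : eval (entries A) (Q * Q) ≠ 0 := by
      rw [map_mul]; exact mul_ne_zero hQ hQ
    rw [hcoord b c a A _ ha hA] at hQQ
    obtain ⟨r, -, hr⟩ := Finset.exists_ne_zero_of_sum_ne_zero hQQ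
    have hr' := right_ne_zero_of_mul hr
    -- The value of `h ∘ g` is the same for all the roots `a`, so the identity can be compared
    -- coefficient by coefficient in `a`. The index `r` was chosen with non-zero coefficient at the
    -- given point, so `h ∘ g` is there a quotient of rational functions.
    have hrel : ∀ e : B.piece b, eval (B.coord b e) (D b) ≠ 0 →
        h (g (B.toSpace b e)) * p b (Q * Q) r (B.coord b e) = p b (P * Q) r (B.coord b e) := by
      intro e he
      have hz := congrFun (eq_zero_of_forall_root (c := fun r =>
        h (g (B.toSpace b e)) * p b (Q * Q) r (B.coord b e) - p b (P * Q) r (B.coord b e)) he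
        fun a' ha' => ?_) r
      · exact sub_eq_zero.1 hz
      · obtain ⟨A', hA'⟩ := lift b e a' ha'
        have h1 := hPQ' A'
        rw [hg b e a' A' hA', hcoord b e a' A' _ ha' hA', hcoord b e a' A' _ ha' hA',
          Finset.mul_sum] at h1
        rw [← sub_eq_zero, ← Finset.sum_sub_distrib] at h1
        rw [← h1]
        exact Finset.sum_congr rfl fun r _ => by ring
    obtain ⟨N, P', hP'⟩ := hp b (P * Q) r
    obtain ⟨K, Q', hQ'⟩ := hp b (Q * Q) r
    refine ⟨P' * D b ^ (K + 1), Q' * D b ^ (N + 1), ?_, fun e he => ?_⟩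
    · rw [map_mul, map_pow]
      refine mul_ne_zero (fun h0 => hr' ?_) (pow_ne_zero _ hc1)
      rw [hQ' _ hc1, h0, zero_div]
    · rw [map_mul, map_pow] at he
      have he1 := left_ne_zero_of_mul he
      have he2 : eval (B.coord b e) (D b) ≠ 0 := fun h0 =>
        right_ne_zero_of_mul he (by rw [h0, zero_pow N.succ_ne_zero])
      have h1 := hrel e he2
      rw [hP' _ he2, hQ' _ he2] at h1
      rw [Function.comp_apply, eq_div_iff (by rw [map_mul, map_pow]; exact he)]
      simp only [map_mul, map_pow]
      field_simp at h1
      linear_combination (eval (B.coord b e) (D b)) * h1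

end Morphisms

/-! ### The orbit map, its inverse, and density of the open orbit. -/

section OrbitMap

open Matrix MvPolynomial

/-- The matrix with the given entries. -/
def ofEntries (x : Fin (n + 1) × Fin (n + 1) → ℂ) : Matrix (Fin (n + 1)) (Fin (n + 1)) ℂ :=
  of fun i j => x (i, j)

theorem ratio_mem {X : Type*} {S : Subalgebra ℂ (X → ℂ)} {i : Fin (n + 1)}
    {v : X → Fin (n + 1) → ℂ} (hv : ∀ k, (fun x => v x k) ∈ S)
    (hi : (fun x => (v x i)⁻¹) ∈ S) (j : Fin n) : (fun x => ratio i (v x) j) ∈ S := by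
  simp only [ratio, div_eq_mul_inv]
  exact fun_mul_mem (hv _) hi

theorem affineRep_mem {X : Type*} {S : Subalgebra ℂ (X → ℂ)} {i : Fin (n + 1)}
    {y : X → Fin n → ℂ} (hy : ∀ k, (fun x => y x k) ∈ S) (k : Fin (n + 1)) :
    (fun x => affineRep i (y x) k) ∈ S := by
  refine Fin.succAboveCases i ?_ (fun j => ?_) k
  · simpa only [affineRep_same] using const_mem 1
  · simpa only [affineRep_succAbove] using hy j

/-- The orbit map is a morphism. -/
theorem isMorphismAt_orbitMap (q : ProjProlongation n) (g : PSL n) :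
    IsMorphismAt (pslVariety n) (prolongationVariety n) (fun g : PSL n => g • q) g := by
  obtain ⟨v, B, hv, rfl⟩ := exists_eq_linearJet q
  let w : (Fin (n + 1) × Fin (n + 1) → ℂ) → Fin (n + 1) → ℂ := fun x => ofEntries x *ᵥ v
  -- The adjugate is polynomial in the entries and equals the inverse on `SL`.
  let C : (Fin (n + 1) × Fin (n + 1) → ℂ) → Matrix (Fin (n + 1)) (Fin (n + 1)) ℂ :=
    fun x => ofEntries x * B * (ofEntries x).adjugate
  have hE : ∀ (S : MvPolynomial (Fin (n + 1) × Fin (n + 1)) ℂ) i j,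
      (fun x => (ofEntries x : Matrix (Fin (n + 1)) (Fin (n + 1)) ℂ) i j) ∈ ratFun S :=
    fun S i j => coord_mem_ratFun S (i, j)
  have hw : ∀ S k, (fun x => w x k) ∈ ratFun S := fun S k =>
    fun_mulVec_mem (hE S) (fun i => const_mem (v i)) k
  have hC : ∀ S i j, (fun x => C x i j) ∈ ratFun S := fun S =>
    fun_matrix_mul_mem (fun_matrix_mul_mem (hE S) fun i j => const_mem (B i j))
      (fun_adjugate_mem (hE S))
  choose D hD using fun i => mem_ratFun_one_iff.1 (hw 1 i)
  have hinv : ∀ i, (fun x => (w x i)⁻¹) ∈ ratFun (D i) := fun i => by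
    simpa only [hD] using inv_mem_ratFun (D i)
  let F : Fin (n + 1) → (Fin n ⊕ Fin n ⊕ Fin n × Fin n) →
      (Fin (n + 1) × Fin (n + 1) → ℂ) → ℂ := fun i m x =>
    (Sum.elim (ratio i (w x)) (Sum.elim
      (fun k => (C x *ᵥ affineRep i (ratio i (w x))) (i.succAbove k) -
        ratio i (w x) k * (C x *ᵥ affineRep i (ratio i (w x))) i)
      (fun jk => C x (i.succAbove jk.2) (i.succAbove jk.1) -
        ((if jk.2 = jk.1 then 1 else 0) * (C x *ᵥ affineRep i (ratio i (w x))) i +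
          ratio i (w x) jk.2 * C x i (i.succAbove jk.1)))) : _ → ℂ) m
  have hF : ∀ i m, F i m ∈ ratFun (D i) := by
    intro i m
    have hr := ratio_mem (hw (D i)) (hinv i)
    have hCr := fun_mulVec_mem (hC (D i)) (affineRep_mem (i := i) hr)
    obtain j | k | ⟨j, k⟩ := m
    · exact hr j
    · exact fun_sub_mem (hCr _) (fun_mul_mem (hr k) (hCr i))
    · exact fun_sub_mem (hC _ _ _) (fun_add_mem (fun_mul_mem (const_mem _) (hCr i))
        (fun_mul_mem (hr k) (hC _ _ _)))
  refine isMorphismAt_of_ratFun (pslVariety n) (prolongationVariety n) _ (fun _ => D)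
    (fun _ => F) (fun _ => hF) ?_ ?_ g
  · intro _ (i : Fin (n + 1)) (A : Matrix.SpecialLinearGroup (Fin (n + 1)) ℂ) hA
    have hA' : (A.1 *ᵥ v) i ≠ 0 := by
      have : eval (entries A) (D i) ≠ 0 := hA
      rwa [← hD] at this
    refine ⟨⟨(QuotientGroup.mk A : PSL n) • linearJet v B, ?_⟩, rfl, ?_⟩
    · rw [mk_smul_linearJet A hv]
      exact (toProj_mem_source_iff i (mulVec_ne_zero A hv)).2 hA'
    · change affineJetCoord i ((QuotientGroup.mk A : PSL n) • linearJet v B) =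
        fun j => F i j (entries A)
      rw [mk_smul_linearJet A hv, affineJetCoord_linearJet i hA',
        Matrix.SpecialLinearGroup.coe_inv]
      rfl
  · intro _ (A : Matrix.SpecialLinearGroup (Fin (n + 1)) ℂ)
    obtain ⟨i, hi⟩ : ∃ i, (A.1 *ᵥ v) i ≠ 0 := by
      by_contra! h
      exact mulVec_ne_zero A hv (funext h)
    refine ⟨i, ?_⟩
    change eval (entries A) (D i) ≠ 0
    rwa [← hD]

/-- The frame of a 1-jet, in terms of its coordinates. -/
def coordFrame (i : Fin (n + 1)) (c : Fin n ⊕ Fin n ⊕ Fin n × Fin n → ℂ) :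
    Matrix (Fin (n + 1)) (Fin (n + 1)) ℂ :=
  frame (jetVector i c) (traceFree (jetMatrix i c))

theorem frame_mem {X : Type*} {S : Subalgebra ℂ (X → ℂ)} {v : X → Fin (n + 1) → ℂ}
    {B : X → Matrix (Fin (n + 1)) (Fin (n + 1)) ℂ} (hv : ∀ k, (fun x => v x k) ∈ S)
    (hB : ∀ i j, (fun x => B x i j) ∈ S) (i j : Fin (n + 1)) :
    (fun x => frame (v x) (B x) i j) ∈ S := by
  simp only [frame, frameVec, of_apply, Finset.sum_apply, Pi.smul_apply, smul_eq_mul]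
  exact fun_sum_mem fun k _ => fun_mul_mem (fun_coeff_charpoly_mem hB _)
    (fun_mulVec_mem (fun_matrix_pow_mem hB k) hv i)

theorem traceFree_mem {X : Type*} {S : Subalgebra ℂ (X → ℂ)}
    {B : X → Matrix (Fin (n + 1)) (Fin (n + 1)) ℂ}
    (hB : ∀ i j, (fun x => B x i j) ∈ S) (i j : Fin (n + 1)) :
    (fun x => traceFree (B x) i j) ∈ S := by
  have h : ∀ x, traceFree (B x) i j = B x i j +
      (∑ k, B x k k) * (-(n + 1 : ℂ)⁻¹ * (1 : Matrix (Fin (n + 1)) (Fin (n + 1)) ℂ) i j) := by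
    intro x
    simp only [traceFree, Matrix.add_apply, Matrix.smul_apply, trace, diag, smul_eq_mul]
    ring
  simp only [h]
  exact fun_add_mem (hB i j) (fun_mul_mem (fun_sum_mem fun k _ => hB k k) (const_mem _))

theorem coordFrame_mem (i r k : Fin (n + 1)) :
    (fun c => coordFrame i c r k) ∈ ratFun (σ := Fin n ⊕ Fin n ⊕ Fin n × Fin n) 1 := by
  refine frame_mem (affineRep_mem fun j => coord_mem_ratFun 1 _) (traceFree_mem fun r k => ?_) r k
  refine Fin.succAboveCases i ?_ (fun r => ?_) r
  · simp only [jetMatrix_same]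
    exact const_mem 0
  · refine Fin.succAboveCases i ?_ (fun k => ?_) k
    · simp only [jetMatrix_succAbove_same]
      exact fun_sub_mem (coord_mem_ratFun 1 _) (fun_sum_mem fun j _ =>
        fun_mul_mem (coord_mem_ratFun 1 _) (coord_mem_ratFun 1 _))
    · simp only [jetMatrix_succAbove]
      exact coord_mem_ratFun 1 _

theorem mem_trivialIsotropy_iff (i : Fin (n + 1)) {q : ProjProlongation n}
    (hq : q.base ∈ (affineChart i).source) :
    q ∈ trivialIsotropy n ↔ (coordFrame i (affineJetCoord i q)).det ≠ 0 := by
  conv_lhs => rw [← linearJet_affineJetCoord i hq]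
  exact linearJet_mem_trivialIsotropy_iff (jetVector_ne_zero i _) _

theorem exists_det_coordFrame_eq (n : ℕ) (i : Fin (n + 1)) :
    ∃ D : MvPolynomial (Fin n ⊕ Fin n ⊕ Fin n × Fin n) ℂ,
      ∀ c, (coordFrame i c).det = eval c D :=
  mem_ratFun_one_iff.1 (fun_det_mem (coordFrame_mem i))

theorem isZariskiOpen_trivialIsotropy (n : ℕ) :
    (prolongationVariety n).IsZariskiOpen (trivialIsotropy n) := by
  intro (i : Fin (n + 1))
  obtain ⟨D, hD⟩ := exists_det_coordFrame_eq n i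
  have key : ∀ p : ProjProlongation n, p.base ∈ (affineChart i).source →
      (p ∈ trivialIsotropy n ↔
        ∃ P ∈ ({D} : Set (MvPolynomial (Fin n ⊕ Fin n ⊕ Fin n × Fin n) ℂ)),
          eval (affineJetCoord i p) P ≠ 0) := fun p hp => by
    rw [mem_trivialIsotropy_iff i hp, hD]
    simp
  exact ⟨{D}, fun c => key c.1 c.2⟩

theorem standardJet_mem_trivialIsotropy (n : ℕ) : standardJet n ∈ trivialIsotropy n :=
  stabilizer_standardJet n

/-- `SL` is transitive on `ℙⁿ`, so the orbit of the standard jet meets every chart. Hence the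
determinant defining `G⁰` is a non-zero polynomial in each chart. -/
theorem exists_mem_trivialIsotropy_chart (i : Fin (n + 1)) :
    ∃ q ∈ trivialIsotropy n, q.base ∈ (affineChart i).source := by
  have he : (Pi.single 0 1 : Fin (n + 1) → ℂ) ≠ 0 := by simp
  have hi : (Pi.single i 1 : Fin (n + 1) → ℂ) ≠ 0 := by simp
  obtain ⟨A, hA⟩ := MulAction.exists_smul_eq (Matrix.SpecialLinearGroup (Fin (n + 1)) ℂ)
    (toProj (Pi.single 0 1) : ProjSpace n) (toProj (Pi.single i 1))
  refine ⟨(QuotientGroup.mk A : PSL n) • standardJet n, ?_, ?_⟩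
  · rw [← orbit_eq_trivialIsotropy (standardJet_mem_trivialIsotropy n)]
    exact MulAction.mem_orbit _ _
  · change (QuotientGroup.mk A : PSL n) • (toProj (Pi.single 0 1) : ProjSpace n) ∈ _
    rw [Matrix.ProjectiveSpecialLinearGroup.smul_proj_mk, hA, toProj_mem_source_iff i hi]
    simp

/-- In a chart, a non-empty open set contains the locus where some non-zero polynomial does not
vanish. Its product with the determinant is non-zero at some point of affine space, and every such
point is the coordinate vector of a jet. -/
theorem isZariskiDense_trivialIsotropy (n : ℕ) :
    (prolongationVariety n).IsZariskiDense (trivialIsotropy n) := by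
  refine (@dense_iff_inter_open _ (prolongationVariety n).zariski _).2 fun U hU ⟨q, hq⟩ => ?_
  obtain ⟨i, hi⟩ := exists_rep_ne_zero q.base
  obtain ⟨D, hD⟩ := exists_det_coordFrame_eq n i
  obtain ⟨S, hS⟩ : ∃ S : Set (MvPolynomial (Fin n ⊕ Fin n ⊕ Fin n × Fin n) ℂ),
      ∀ p : ProjProlongation n, p.base ∈ (affineChart i).source →
        (p ∈ U ↔ ∃ P ∈ S, eval (affineJetCoord i p) P ≠ 0) := by
    obtain ⟨S, hS⟩ := hU i
    exact ⟨S, fun p hp => hS ⟨p, hp⟩⟩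
  obtain ⟨P, hP, hPq⟩ := (hS q hi).1 hq
  obtain ⟨p, hp, hpi⟩ := exists_mem_trivialIsotropy_chart i
  rw [mem_trivialIsotropy_iff i hpi, hD] at hp
  have hP0 : P ≠ 0 := by rintro rfl; simp at hPq
  have hD0 : D ≠ 0 := by rintro rfl; simp at hp
  obtain ⟨c, hc⟩ : ∃ c, eval c (P * D) ≠ 0 := by
    by_contra! h
    exact mul_ne_zero hP0 hD0 (MvPolynomial.funext fun c => by rw [h c, map_zero])
  rw [map_mul] at hc
  have hb := jetVector_mem_source i c (jetMatrix i c)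
  refine ⟨linearJet (jetVector i c) (jetMatrix i c), (hS _ hb).2 ⟨P, hP, ?_⟩,
    (mem_trivialIsotropy_iff i hb).2 ?_⟩
  · rw [affineJetCoord_jetMatrix]
    exact left_ne_zero_of_mul hc
  · rw [affineJetCoord_jetMatrix, hD]
    exact right_ne_zero_of_mul hc

theorem smul_left_injective_of_mem {q : ProjProlongation n} (hq : q ∈ trivialIsotropy n)
    {g h : PSL n} (hgh : g • q = h • q) : g = h := by
  have h1 : h⁻¹ * g ∈ MulAction.stabilizer (PSL n) q := by
    rw [MulAction.mem_stabilizer_iff, mul_smul, hgh, inv_smul_smul]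
  rw [show MulAction.stabilizer (PSL n) q = ⊥ from hq, Subgroup.mem_bot] at h1
  exact (inv_mul_eq_one.1 h1).symm

/-- The open subset of `G` can be taken to be all of `G`, since the orbit map is a bijection onto
`G⁰`. -/
theorem isBirationalMorphism_orbitMap {q : ProjProlongation n} (hq : q ∈ trivialIsotropy n) :
    IsBirationalMorphism (pslVariety n) (prolongationVariety n) (fun g : PSL n => g • q) := by
  have horb := orbit_eq_trivialIsotropy hq
  have hg : ∀ p, ∃ g : PSL n, p ∈ trivialIsotropy n → g • q = p := fun p => by
    by_cases hp : p ∈ trivialIsotropy n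
    · rw [← horb] at hp
      obtain ⟨g, hg⟩ := hp
      exact ⟨g, fun _ => hg⟩
    -- Outside `G⁰` the inverse takes an irrelevant value.
    · exact ⟨1, fun h => (hp h).elim⟩
  choose φ hφ using hg
  have hmem : ∀ g : PSL n, g • q ∈ trivialIsotropy n := fun g => by
    rw [← horb]; exact MulAction.mem_orbit _ _
  refine ⟨isMorphismAt_orbitMap q, Set.univ, trivialIsotropy n, φ,
    @isOpen_univ _ (pslVariety n).zariski, @dense_univ _ (pslVariety n).zariski,
    isZariskiOpen_trivialIsotropy n, isZariskiDense_trivialIsotropy n, fun g _ => hmem g,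
    fun _ _ => trivial, fun g _ => smul_left_injective_of_mem hq (hφ _ (hmem g)), hφ,
    fun y hy => ?_⟩
  obtain ⟨g₀, hg₀⟩ : ∃ g₀ : PSL n, g₀ • standardJet n = q := by
    rw [← orbit_eq_trivialIsotropy (standardJet_mem_trivialIsotropy n)] at hq
    exact hq
  induction g₀ using QuotientGroup.induction_on with | _ A₀
  have hA₀ : (A₀⁻¹).1 * A₀.1 = 1 := congrArg Subtype.val (inv_mul_cancel A₀)
  -- With `q = A₀ • standardJet`, a matrix `A` satisfies `A • q = p` as soon as `A A₀` is a multiple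
  -- of the frame of `p`. This accounts for the factor `A₀⁻¹`, of determinant one.
  refine isMorphismAt_pslVariety (prolongationVariety n) φ
    (fun i c => coordFrame i c * (A₀⁻¹).1)
    (fun i => fun_matrix_mul_mem (coordFrame_mem i) fun r k => const_mem _)
    (isZariskiOpen_trivialIsotropy n) (fun i p => ?_) (fun i p a A hA => ?_) hy
  · rw [det_mul, (A₀⁻¹).2, mul_one]
    exact mem_trivialIsotropy_iff i p.2
  · have h1 : (A * A₀).1 = a • coordFrame i (affineJetCoord i p.1) := by
      change A.1 * A₀.1 = _
      rw [hA, Matrix.smul_mul, mul_assoc, hA₀, mul_one]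
      rfl
    have h2 : (QuotientGroup.mk A : PSL n) • q = p.1 := by
      have h3 := mk_smul_standardJet (jetVector_ne_zero i _) _ (A * A₀) h1
      rw [linearJet_affineJetCoord i p.2, QuotientGroup.mk_mul, mul_smul, hg₀] at h3
      exact h3
    have hp : p.1 ∈ trivialIsotropy n := h2 ▸ hmem _
    exact smul_left_injective_of_mem hq (h2.trans (hφ _ hp).symm)

end OrbitMap

end ProlongedProj

end

theorem mainTheorem7 (n : ℕ) :
    (ProlongedProj.prolongationVariety n).IsZariskiOpen (ProlongedProj.trivialIsotropy n) ∧
    (ProlongedProj.trivialIsotropy n).Nonempty ∧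
    ∀ q ∈ ProlongedProj.trivialIsotropy n,
      ProlongedProj.IsBirationalMorphism (ProlongedProj.pslVariety n)
        (ProlongedProj.prolongationVariety n) (fun g : ProlongedProj.PSL n => g • q) ∧
      MulAction.orbit (ProlongedProj.PSL n) q = ProlongedProj.trivialIsotropy n :=
  ⟨ProlongedProj.isZariskiOpen_trivialIsotropy n,
    ⟨_, ProlongedProj.standardJet_mem_trivialIsotropy n⟩, fun _ hq =>
    ⟨ProlongedProj.isBirationalMorphism_orbitMap hq, ProlongedProj.orbit_eq_trivialIsotropy hq⟩⟩
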